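/- **Setting.** Let $\mathcal M$ be a compact smooth $d$-dimensional manifold with a fixed atlas of charts, and let $\mu$ be a Borel probability measure on $\mathcal M$ that is absolutely continuous with respect to Lebesgue measure. A set $\Sigma\subset\mathbb R^d$ has Minkowski content zero if the Lebesgue measure of its closed $\epsilon$-neighbourhood tends to $0$ as $\epsilon\to0$; a subset of $\mathcal M$ has Minkowski content zero if its images in all charts of the atlas do. Let $\Phi:\mathcal M\to\mathcal M$ be an invertible, $\mu$-preserving, piecewise smooth map: there are countably many disjoint open sets $\mathcal U_i$ with $\mathcal M=\overline{\bigcup_i\mathcal U_i}$, such that each $\Phi|_{\mathcal U_i}$ extends smoothly to $\overline{\mathcal U_i}$ and $\overline{\bigcup_i\partial\mathcal U_i}$ has Minkowski content zero. The domain of continuity of $\Phi$ is $\mathcal C=\mathcal M\setminus\overline{\bigcup_i\partial\mathcal U_i}$, and that of $\Phi^k$ ($k\ge1$) is $\{x: \Phi^i x\in\mathcal C,\ 0\le i<k\}$. Let $\mathcal I\subset\mathbb N$ be infinite; all limits $N\to\infty$ are along $\mathcal I$. For sequences of $N\times N$ matrices write $A\sim B$ if $\|A_N-B_N\|\to0$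 in operator norm. Let $\operatorname{Op}_N:C^\infty(\mathcal M)\to M_N(\mathbb C)$ ($N\in\mathcal I$) be linear maps on the smooth complex-valued functions such that, for all smooth $a,a_1,a_2$, $$\operatorname{Op}(\bar a)\sim\operatorname{Op}(a)^\dagger,\qquad \operatorname{Op}(a_1)\operatorname{Op}(a_2)\sim\operatorname{Op}(a_1a_2),\qquad \tfrac1N\operatorname{Tr}\operatorname{Op}_N(a)\to\int_{\mathcal M}a\,d\mu ,$$ and let $U_N$ ($N\in\mathcal I$) be unitary $N\times N$ matrices such that $U^{-1}\operatorname{Op}(a)U\sim\operatorname{Op}(a\circ\Phi)$ for every smooth $a$ for which both $a$ and $a\circ\Phi$ have compact support contained in $\mathcal C$ (so that $a\circ\Phi$ is smooth). Let $\mathcal D_\nu\subset\mathcal M$ ($\nu=1,2,\dots$) be disjoint, possibly empty sets whose boundaries have Minkowski content zero, let $n_\nu\ge1$ be integers and $\alpha_\nu$ real numbers, and put $\mathcal D_0=\mathcal M\setminus\bigcup_{\nu\ge1}\mathcal D_\nu$. Assume: (a) $\Phi^{n_\nu}|_{\mathcal D_\nu}=\mathrm{id}$, and for $0<|n|<n_\nu$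 the fixed points of $\Phi^n$ on $\mathcal D_\nu$ form a set of Minkowski content zero; (b) for every integer $n\ne0$ the fixed points of $\Phi^n$ on $\mathcal D_0$ form a set of Minkowski content zero; (c) $U^{n_\nu}\operatorname{Op}(a)\sim e^{2\pi i n_\nu\alpha_\nu}\operatorname{Op}(a)$ for every smooth $a$ with compact support contained in $\mathcal D_\nu$ and in the domains of continuity of $\Phi,\Phi^2,\dots,\Phi^{n_\nu}$. For each $N\in\mathcal I$ let $\varphi_1,\dots,\varphi_N$ be an orthonormal basis of $\mathbb C^N$ consisting of eigenvectors of $U_N$ (both $\varphi_j$ and $U_N$ may depend on $N$). **Theorem (quantum ergodicity).** Suppose in addition that $\Phi$ acts ergodically on $\mathcal D_0$ with respect to the restriction of $\mu$ to $\mathcal D_0$. Then there are sets $J_N\subset\{1,\dots,N\}$ ($N\in\mathcal I$) with density $\lim_{N\to\infty}\#J_N/N=\mu(\mathcal D_0)$ such that $$\lim_{N\to\infty}\frac1N\sum_{j\in J_N}\left|\langle\operatorname{Op}_N(a)\varphi_j,\varphi_j\rangle\right|^2=0\quad\text{for every smooth } a \text{ with } a|_{\mathcal D_0}=0. \tag{i}$$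 Moreover, for all sets $J_N$ having this density and property (i), and for every $a\in C^\infty(\mathcal M)$, $$\lim_{N\to\infty}\frac1N\sum_{j\in J_N}\left|\langle\operatorname{Op}_N(a)\varphi_j,\varphi_j\rangle-\frac1{\mu(\mathcal D_0)}\int_{\mathcal D_0}a\,d\mu\right|^2=0 ,$$ where the mean value is read as $0$ if $\mu(\mathcal D_0)=0$. -/

import Mathlib

open Filter Topology MeasureTheory
open scoped Manifold ContDiff Matrix

namespace DividedPhaseSpace

/-! ### Minkowski content -/

/-- The `s`-dimensional upper Minkowski content of `S ⊆ ℝ^d`, that is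
`limsup_{ε → 0+} (2ε)^(s-d) · vol {ξ | dist(ξ, S) ≤ ε}`. -/
noncomputable def upperMinkowskiContent {d : ℕ} (s : ℝ)
    (S : Set (EuclideanSpace ℝ (Fin d))) : ENNReal :=
  limsup (fun ε : ℝ => ENNReal.ofReal ((2 * ε) ^ (s - (d : ℝ))) * volume (Metric.cthickening ε S))
    (𝓝[>] 0)

/-- A subset of a manifold has Minkowski content zero if its image in every chart of the given
atlas has vanishing `d`-dimensional upper Minkowski content. -/
def MinkowskiContentZero (d : ℕ) {M : Type*} [TopologicalSpace M]
    [ChartedSpace (EuclideanSpace ℝ (Fin d)) M] (S : Set M) : Prop :=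
  ∀ e ∈ atlas (EuclideanSpace ℝ (Fin d)) M, upperMinkowskiContent (d : ℝ) (e '' (S ∩ e.source)) = 0

/-- `μ` is absolutely continuous with respect to Lebesgue measure (in every chart). -/
def AbsContLebesgue (d : ℕ) {M : Type*} [TopologicalSpace M] [MeasurableSpace M]
    [ChartedSpace (EuclideanSpace ℝ (Fin d)) M] (μ : Measure M) : Prop :=
  ∀ e ∈ atlas (EuclideanSpace ℝ (Fin d)) M, ∀ s : Set (EuclideanSpace ℝ (Fin d)),
    volume s = 0 → μ (e.source ∩ e ⁻¹' s) = 0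

/-! ### Piecewise smooth maps -/

/-- `Φ` is piecewise smooth with respect to the countable family of open pieces `𝒰 i` (pieces may
be empty): the pieces are disjoint with dense union, on each piece `Φ` extends to a map that is
smooth on the closure of the piece, and the closure of the union of the boundaries of the pieces
has Minkowski content zero. -/
structure IsPiecewiseSmooth (d : ℕ) {M : Type*} [TopologicalSpace M]
    [ChartedSpace (EuclideanSpace ℝ (Fin d)) M] (Φ : M → M) (𝒰 : ℕ → Set M) : Prop where
  isOpen : ∀ i, IsOpen (𝒰 i)
  disjoint : Pairwise fun i j => Disjoint (𝒰 i) (𝒰 j)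
  dense : closure (⋃ i, 𝒰 i) = Set.univ
  smooth : ∀ i, ∃ Ψ : M → M, Set.EqOn Ψ Φ (𝒰 i) ∧ ContMDiffOn (𝓡 d) (𝓡 d) ∞ Ψ (closure (𝒰 i))
  boundary : MinkowskiContentZero d (closure (⋃ i, frontier (𝒰 i)))

/-- The domain of continuity of `Φ`: the complement of the closure of the union of the boundaries
of the pieces. -/
def continuityDomain {M : Type*} [TopologicalSpace M] (𝒰 : ℕ → Set M) : Set M :=
  (closure (⋃ i, frontier (𝒰 i)))ᶜ

/-- The domain of continuity of the iterate `Φ^k`: the points `x` such that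
`x, Φ x, …, Φ^(k-1) x` all lie in the domain of continuity of `Φ`. -/
def iterateContinuityDomain {M : Type*} [TopologicalSpace M] (Φ : M → M) (𝒰 : ℕ → Set M)
    (k : ℕ) : Set M :=
  {x | ∀ i < k, Φ^[i] x ∈ continuityDomain 𝒰}

/-! ### Quantum observables and quantum maps -/

/-- The `*`-algebra `C^∞(M)` of smooth complex-valued functions on `M`. -/
def smoothFunctions (d : ℕ) (M : Type*) [TopologicalSpace M]
    [ChartedSpace (EuclideanSpace ℝ (Fin d)) M] : StarSubalgebra ℂ (M → ℂ) where
  carrier := {f | ContMDiff (𝓡 d) 𝓘(ℝ, ℂ) ∞ f}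
  mul_mem' {a b} ha hb :=
    ContMDiff.comp (g := fun p : ℂ × ℂ => p.1 * p.2) (f := fun x => (a x, b x))
      (contDiff_mul (𝕜 := ℝ) (𝔸 := ℂ)).contMDiff (ContMDiff.prodMk_space ha hb)
  add_mem' ha hb := ContMDiff.add ha hb
  algebraMap_mem' _ := contMDiff_const
  star_mem' {a} ha :=
    ContMDiff.comp (g := fun z : ℂ => star z) (f := a)
      (Complex.conjCLE.contDiff.contMDiff) ha

/-- The limit `N → ∞` along the index set `I`. -/
def limAlong (I : Set ℕ) : Filter ℕ := atTop ⊓ 𝓟 I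

/-- The operator norm of a matrix acting on `ℂ^N` with its Euclidean norm. -/
noncomputable def opNorm {N : ℕ} (A : Matrix (Fin N) (Fin N) ℂ) : ℝ :=
  ‖Matrix.toEuclideanCLM (n := Fin N) (𝕜 := ℂ) A‖

/-- Semiclassical equivalence of two sequences of matrices: `‖A_N - B_N‖ → 0` as `N → ∞`
in `I`. -/
def SemiclassicalEquiv (I : Set ℕ) (A B : (N : ℕ) → Matrix (Fin N) (Fin N) ℂ) : Prop :=
  Tendsto (fun N => opNorm (A N - B N)) (limAlong I) (𝓝 0)

/-- The correspondence principle for quantum observables. -/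
structure ObservableCorrespondence {d : ℕ} {M : Type*} [TopologicalSpace M]
    [ChartedSpace (EuclideanSpace ℝ (Fin d)) M] [MeasurableSpace M] (μ : Measure M) (I : Set ℕ)
    (Op : (N : ℕ) → smoothFunctions d M →ₗ[ℂ] Matrix (Fin N) (Fin N) ℂ) : Prop where
  conj : ∀ a : smoothFunctions d M,
    SemiclassicalEquiv I (fun N => Op N (star a)) (fun N => (Op N a)ᴴ)
  mul : ∀ a₁ a₂ : smoothFunctions d M,
    SemiclassicalEquiv I (fun N => Op N a₁ * Op N a₂) (fun N => Op N (a₁ * a₂))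
  trace : ∀ a : smoothFunctions d M,
    Tendsto (fun N : ℕ => (1 / (N : ℂ)) * (Op N a).trace) (limAlong I)
      (𝓝 (∫ x, (a : M → ℂ) x ∂μ))

/-- The correspondence principle for quantum maps: `U^{-1} Op(a) U ∼ Op(a ∘ Φ)`. It is required
only of those smooth `a` for which both `a` and `a ∘ Φ` are supported in the domain of continuity
of `Φ`; the latter makes `a ∘ Φ` smooth, so that `Op(a ∘ Φ)` is defined. -/
def MapCorrespondence {d : ℕ} {M : Type*} [TopologicalSpace M]
    [ChartedSpace (EuclideanSpace ℝ (Fin d)) M] (Φ : M → M) (𝒰 : ℕ → Set M) (I : Set ℕ)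
    (Op : (N : ℕ) → smoothFunctions d M →ₗ[ℂ] Matrix (Fin N) (Fin N) ℂ)
    (U : (N : ℕ) → Matrix.unitaryGroup (Fin N) ℂ) : Prop :=
  ∀ a b : smoothFunctions d M, (b : M → ℂ) = (a : M → ℂ) ∘ Φ →
    tsupport (a : M → ℂ) ⊆ continuityDomain 𝒰 → tsupport (b : M → ℂ) ⊆ continuityDomain 𝒰 →
    SemiclassicalEquiv I
      (fun N => ((U N)⁻¹ : Matrix.unitaryGroup (Fin N) ℂ).1 * Op N a * (U N).1)
      (fun N => Op N b)

/-- Hypotheses (a), (b), (c) of Weyl's law. The periodic domains are `D 0, D 1, …` (some of them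
may be empty), with periods `n ν` and phases `α ν`; the remaining set is
`(⋃ ν, D ν)ᶜ`. -/
structure PeriodicDomains {d : ℕ} {M : Type*} [TopologicalSpace M]
    [ChartedSpace (EuclideanSpace ℝ (Fin d)) M] (Φ : Equiv.Perm M) (𝒰 : ℕ → Set M) (I : Set ℕ)
    (Op : (N : ℕ) → smoothFunctions d M →ₗ[ℂ] Matrix (Fin N) (Fin N) ℂ)
    (U : (N : ℕ) → Matrix.unitaryGroup (Fin N) ℂ)
    (D : ℕ → Set M) (n : ℕ → ℕ) (α : ℕ → ℝ) : Prop where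
  disjoint : Pairwise fun ν κ => Disjoint (D ν) (D κ)
  boundary : ∀ ν, MinkowskiContentZero d (frontier (D ν))
  one_le : ∀ ν, 1 ≤ n ν
  periodic : ∀ ν, ∀ x ∈ D ν, (Φ ^ n ν) x = x
  fixed_of_lt : ∀ ν, ∀ k : ℤ, 0 < |k| → |k| < (n ν : ℤ) →
    MinkowskiContentZero d {x ∈ D ν | (Φ ^ k) x = x}
  fixed_compl : ∀ k : ℤ, k ≠ 0 → MinkowskiContentZero d {x ∈ (⋃ ν, D ν)ᶜ | (Φ ^ k) x = x}
  phase : ∀ ν, ∀ a : smoothFunctions d M, tsupport (a : M → ℂ) ⊆ D ν →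
    (∀ k, 1 ≤ k → k ≤ n ν → tsupport (a : M → ℂ) ⊆ iterateContinuityDomain Φ 𝒰 k) →
    SemiclassicalEquiv I (fun N => (U N).1 ^ n ν * Op N a)
      (fun N => Complex.exp (2 * Real.pi * Complex.I * (n ν * α ν)) • Op N a)

/-! ### Eigenstates and index sets -/

/-- `⟨A φ, φ⟩`, the inner product being linear in its first entry. (Mathlib's `inner` is linear in
its second entry.) -/
noncomputable def expectation {N : ℕ} (A : Matrix (Fin N) (Fin N) ℂ)
    (φ : EuclideanSpace ℂ (Fin N)) : ℂ :=
  inner ℂ φ (Matrix.toEuclideanCLM (n := Fin N) (𝕜 := ℂ) A φ)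

/-- The sequence of index sets `J_N ⊆ {1, …, N}` has density `δ`. -/
def HasDensity (I : Set ℕ) (J : (N : ℕ) → Finset (Fin N)) (δ : ℝ) : Prop :=
  Tendsto (fun N : ℕ => ((J N).card : ℝ) / (N : ℝ)) (limAlong I) (𝓝 δ)

/-- On average, the states `φ_j` with `j ∈ J_N` put no mass outside `D₀`: for each smooth `a`
vanishing on `D₀`, `(1/N) ∑_{j ∈ J_N} |⟨Op_N(a) φ_j, φ_j⟩|² → 0`. -/
def LocalisedOn {d : ℕ} {M : Type*} [TopologicalSpace M]
    [ChartedSpace (EuclideanSpace ℝ (Fin d)) M] (I : Set ℕ)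
    (Op : (N : ℕ) → smoothFunctions d M →ₗ[ℂ] Matrix (Fin N) (Fin N) ℂ)
    (φ : (N : ℕ) → OrthonormalBasis (Fin N) ℂ (EuclideanSpace ℂ (Fin N)))
    (J : (N : ℕ) → Finset (Fin N)) (D₀ : Set M) : Prop :=
  ∀ a : smoothFunctions d M, (∀ x ∈ D₀, (a : M → ℂ) x = 0) →
    Tendsto (fun N : ℕ => (1 / (N : ℝ)) * ∑ j ∈ J N, ‖expectation (Op N a) (φ N j)‖ ^ 2)
      (limAlong I) (𝓝 0)

end DividedPhaseSpace

open Filter Topology MeasureTheory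
open scoped Manifold ContDiff Matrix

namespace DividedPhaseSpace

set_option linter.unusedSectionVars false

/-! ### Hilbert–Schmidt estimates -/

section HilbertSchmidt

variable {N : ℕ}

/-! No time averages are taken; the argument is Hilbert space duality. By the trace and product
axioms the normalised Hilbert–Schmidt norm of `Op N a` tends to the `L²(μ)` norm of `a`
(`tendsto_nhs`). Suppose that seminorms `p N` on observables are bounded by this norm. The
observables with `p N a → 0` then form a subspace that is closed in `L²` among smooth functions, so
to show that `a` belongs to it one may test `a` against every `g ∈ L²` orthogonal to that subspace
(`HSBounded.mem_nullObservables`, `mem_nullClosure_of_forall_inner`). Each relation known for the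
matrices becomes a property of `g`.

Variance (`tendsto_variance_of_localisedOn`): take for `p` the quadratic mean of expectation values
over `J N`. Conjugation by `U` does not change expectation values in eigenvectors, so by Egorov's
theorem `c - c ∘ Φ` is negligible, and `g` is `Φ`-invariant. Property (i) makes `g` vanish off `D₀`.
Ergodicity then makes `g` a multiple of the indicator of `D₀`, which is orthogonal to `a` minus its
mean over `D₀`.

Existence (`exists_localisedOn`): take for `p` the modulus of the normalised trace of `Op N a` times
`U^k`, `k ≠ 0`. Egorov and cyclicity of the trace make `(c - c ∘ Φ^|k|) a` negligible, so `g`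
vanishes off the fixed points of `Φ^|k|`. Almost every point of `D₀` is aperiodic, so by Weyl's
criterion the eigenphases, weighted by an observable close to the indicator of `D₀`, equidistribute.
It follows that a thin neighbourhood of finitely many phases contains at most about `(1 - μ(D₀)) N`
eigenphases (`eventually_mean_le`). An eigenvector whose phase stays away from the solutions of
`e^{2πi n_ν t} = e^{2πi n_ν α_ν}` has small expectation on observables in `D ν`, because `U^{n_ν}`
acts there almost as a scalar. Discarding the bad phases, and a diagonal argument over a countable
dense family of observables, produce `J`. -/

/-- The tuple of vectors `A φ_j`; its norm is the Hilbert–Schmidt norm of `A`. -/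
noncomputable def hsVec (φ : OrthonormalBasis (Fin N) ℂ (EuclideanSpace ℂ (Fin N))) :
    Matrix (Fin N) (Fin N) ℂ →ₗ[ℂ] PiLp 2 (fun _ : Fin N => EuclideanSpace ℂ (Fin N)) where
  toFun A := WithLp.toLp 2 fun j => Matrix.toEuclideanCLM (n := Fin N) (𝕜 := ℂ) A (φ j)
  map_add' A B := by ext; simp
  map_smul' c A := by ext; simp

/-- The normalised Hilbert–Schmidt norm `(N⁻¹ Tr A†A)^(1/2)`. -/
noncomputable def nhs (φ : OrthonormalBasis (Fin N) ℂ (EuclideanSpace ℂ (Fin N)))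
    (A : Matrix (Fin N) (Fin N) ℂ) : ℝ :=
  ‖hsVec φ A‖ / √N

variable (φ : OrthonormalBasis (Fin N) ℂ (EuclideanSpace ℂ (Fin N)))

@[simp] lemma hsVec_apply (A : Matrix (Fin N) (Fin N) ℂ) (j : Fin N) :
    hsVec φ A j = Matrix.toEuclideanCLM (n := Fin N) (𝕜 := ℂ) A (φ j) := rfl

lemma norm_hsVec_sq (A : Matrix (Fin N) (Fin N) ℂ) :
    ‖hsVec φ A‖ ^ 2 = ∑ j, ‖Matrix.toEuclideanCLM (n := Fin N) (𝕜 := ℂ) A (φ j)‖ ^ 2 := by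
  rw [PiLp.norm_sq_eq_of_L2]; rfl

lemma trace_eq_sum_expectation (A : Matrix (Fin N) (Fin N) ℂ) :
    A.trace = ∑ j, expectation A (φ j) := by
  have h := LinearMap.trace_eq_sum_inner
    (Matrix.toEuclideanLin A : EuclideanSpace ℂ (Fin N) →ₗ[ℂ] EuclideanSpace ℂ (Fin N)) φ
  rw [Matrix.toEuclideanLin_eq_toLin_orthonormal, Matrix.trace_toLin_eq] at h
  rw [h, ← Matrix.toEuclideanLin_eq_toLin_orthonormal]
  rfl

lemma toEuclideanCLM_conjTranspose (A : Matrix (Fin N) (Fin N) ℂ) :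
    Matrix.toEuclideanCLM (n := Fin N) (𝕜 := ℂ) Aᴴ
      = ContinuousLinearMap.adjoint (Matrix.toEuclideanCLM (n := Fin N) (𝕜 := ℂ) A) :=
  map_star (Matrix.toEuclideanCLM (n := Fin N) (𝕜 := ℂ)) A

lemma inner_hsVec (A B : Matrix (Fin N) (Fin N) ℂ) :
    inner ℂ (hsVec φ A) (hsVec φ B) = (Aᴴ * B).trace := by
  rw [trace_eq_sum_expectation φ, PiLp.inner_apply]
  refine Finset.sum_congr rfl fun j _ => ?_
  simp only [hsVec_apply, expectation, map_mul, toEuclideanCLM_conjTranspose]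
  rw [mul_apply_eq_comp, ContinuousLinearMap.adjoint_inner_right]

lemma opNorm_nonneg (A : Matrix (Fin N) (Fin N) ℂ) : 0 ≤ opNorm A := norm_nonneg _

lemma opNorm_mul_le (A B : Matrix (Fin N) (Fin N) ℂ) : opNorm (A * B) ≤ opNorm A * opNorm B := by
  rw [opNorm, map_mul]; exact norm_mul_le _ _

lemma opNorm_unitary_le (V : Matrix.unitaryGroup (Fin N) ℂ) : opNorm V.1 ≤ 1 := by
  refine ContinuousLinearMap.opNorm_le_bound _ zero_le_one fun x => ?_
  have h : ‖Matrix.toEuclideanCLM (n := Fin N) (𝕜 := ℂ) V.1 x‖ ^ 2 = ‖x‖ ^ 2 := by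
    rw [← inner_self_eq_norm_sq (𝕜 := ℂ), ← inner_self_eq_norm_sq (𝕜 := ℂ),
      ← ContinuousLinearMap.adjoint_inner_right, ← toEuclideanCLM_conjTranspose,
      ← mul_apply_eq_comp, ← map_mul]
    have : (V.1)ᴴ * V.1 = 1 := Matrix.mem_unitaryGroup_iff'.1 V.2
    rw [this, map_one, one_apply_eq_self]
  rw [one_mul]
  exact le_of_eq ((sq_eq_sq₀ (norm_nonneg _) (norm_nonneg _)).1 h)

lemma opNorm_add_le (A B : Matrix (Fin N) (Fin N) ℂ) : opNorm (A + B) ≤ opNorm A + opNorm B := by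
  rw [opNorm, map_add]; exact norm_add_le _ _

lemma nhs_nonneg (A : Matrix (Fin N) (Fin N) ℂ) : 0 ≤ nhs φ A := by
  unfold nhs; positivity

lemma norm_expectation_le (A : Matrix (Fin N) (Fin N) ℂ) (j : Fin N) :
    ‖expectation A (φ j)‖ ≤ ‖Matrix.toEuclideanCLM (n := Fin N) (𝕜 := ℂ) A (φ j)‖ := by
  refine (norm_inner_le_norm _ _).trans ?_
  simp

lemma norm_expectation_le_opNorm (A : Matrix (Fin N) (Fin N) ℂ) (j : Fin N) :
    ‖expectation A (φ j)‖ ≤ opNorm A := by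
  refine (norm_expectation_le φ A j).trans ?_
  simpa [opNorm] using (Matrix.toEuclideanCLM (n := Fin N) (𝕜 := ℂ) A).le_opNorm (φ j)

lemma nhs_sq (A : Matrix (Fin N) (Fin N) ℂ) :
    nhs φ A ^ 2 = (1 / (N : ℝ)) * ∑ j, ‖Matrix.toEuclideanCLM (n := Fin N) (𝕜 := ℂ) A (φ j)‖ ^ 2 := by
  rw [nhs, div_pow, norm_hsVec_sq, Real.sq_sqrt (Nat.cast_nonneg N)]
  ring

lemma nhs_sq_eq_trace (A : Matrix (Fin N) (Fin N) ℂ) :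
    (nhs φ A : ℂ) ^ 2 = (1 / (N : ℂ)) * (Aᴴ * A).trace := by
  have h : ((√(N : ℝ) : ℝ) : ℂ) ^ 2 = N := by
    rw [← Complex.ofReal_pow, Real.sq_sqrt (Nat.cast_nonneg N)]; simp
  rw [← inner_hsVec φ, inner_self_eq_norm_sq_to_K, nhs, Complex.ofReal_div, div_pow, h]
  simp [div_eq_inv_mul]

lemma nhs_mul_le (A B : Matrix (Fin N) (Fin N) ℂ) : nhs φ (A * B) ≤ opNorm A * nhs φ B := by
  have h : ‖hsVec φ (A * B)‖ ≤ opNorm A * ‖hsVec φ B‖ := by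
    refine le_of_abs_le <| abs_le_of_sq_le_sq ?_ (mul_nonneg (opNorm_nonneg A) (norm_nonneg _))
    rw [mul_pow, norm_hsVec_sq, norm_hsVec_sq, Finset.mul_sum]
    refine Finset.sum_le_sum fun j _ => ?_
    rw [← mul_pow, map_mul, mul_apply_eq_comp]
    gcongr
    exact ContinuousLinearMap.le_opNorm _ _
  rw [nhs, nhs, ← mul_div_assoc]
  gcongr

lemma nhs_one_le : nhs φ 1 ≤ 1 := by
  rw [← sq_le_one_iff₀ (nhs_nonneg φ 1), nhs_sq]
  simp only [map_one, one_apply_eq_self, OrthonormalBasis.norm_eq_one, one_pow,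
    Finset.sum_const, Finset.card_univ, Fintype.card_fin, nsmul_eq_mul, mul_one, one_div]
  exact inv_mul_le_one

lemma nhs_le_opNorm (A : Matrix (Fin N) (Fin N) ℂ) : nhs φ A ≤ opNorm A := by
  have := nhs_mul_le φ A 1
  rw [mul_one] at this
  exact this.trans (mul_le_of_le_one_right (opNorm_nonneg A) (nhs_one_le φ))

/-- `N⁻¹ ∑ h_j ⟨A φ_j, φ_j⟩`. -/
noncomputable def weightedTrace (h : Fin N → ℂ) :
    Matrix (Fin N) (Fin N) ℂ →ₗ[ℂ] ℂ where
  toFun A := (1 / (N : ℂ)) * ∑ j, h j * expectation A (φ j)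
  map_add' A B := by
    simp only [expectation, map_add, add_apply, inner_add_right, mul_add,
      Finset.sum_add_distrib]
  map_smul' c A := by
    simp only [expectation, map_smul, smul_apply, inner_smul_right,
      RingHom.id_apply, smul_eq_mul, Finset.mul_sum]
    refine Finset.sum_congr rfl fun j _ => by ring

lemma weightedTrace_apply (h : Fin N → ℂ) (A : Matrix (Fin N) (Fin N) ℂ) :
    weightedTrace φ h A = (1 / (N : ℂ)) * ∑ j, h j * expectation A (φ j) := rfl

/-- Cauchy–Schwarz in `j`, with `1/N` shared equally between the factors. Keeping the quadratic mean
of the weights, not their supremum, is what gives the sharp constant in `eventually_mean_le`. -/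
lemma norm_weightedTrace_le_sqrt (h : Fin N → ℂ) (A : Matrix (Fin N) (Fin N) ℂ) :
    ‖weightedTrace φ h A‖ ≤ √((1 / (N : ℝ)) * ∑ j, ‖h j‖ ^ 2) * nhs φ A := by
  rw [weightedTrace_apply, norm_mul]
  have h1 : ‖∑ j, h j * expectation A (φ j)‖ ≤ √(∑ j, ‖h j‖ ^ 2) * ‖hsVec φ A‖ := by
    calc ‖∑ j, h j * expectation A (φ j)‖
        ≤ ∑ j, ‖h j‖ * ‖Matrix.toEuclideanCLM (n := Fin N) (𝕜 := ℂ) A (φ j)‖ := by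
          refine (norm_sum_le _ _).trans (Finset.sum_le_sum fun j _ => ?_)
          rw [norm_mul]
          gcongr
          exact norm_expectation_le φ A j
      _ ≤ √(∑ j, ‖h j‖ ^ 2) * √(∑ j, ‖Matrix.toEuclideanCLM (n := Fin N) (𝕜 := ℂ) A (φ j)‖ ^ 2) :=
          Real.sum_mul_le_sqrt_mul_sqrt _ _ _
      _ = _ := by rw [← norm_hsVec_sq, Real.sqrt_sq (norm_nonneg _)]
  have h2 : ‖(1 / (N : ℂ))‖ = 1 / √(N : ℝ) * (1 / √(N : ℝ)) := by
    rw [norm_div, norm_one, Complex.norm_natCast,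
      div_mul_div_comm, one_mul, Real.mul_self_sqrt (Nat.cast_nonneg N)]
  rw [h2, nhs, Real.sqrt_mul (by positivity), Real.sqrt_div zero_le_one, Real.sqrt_one]
  calc _ ≤ 1 / √(N : ℝ) * (1 / √(N : ℝ)) * (√(∑ j, ‖h j‖ ^ 2) * ‖hsVec φ A‖) := by gcongr
    _ = _ := by ring

lemma norm_weightedTrace_le (h : Fin N → ℂ) {C : ℝ} (hC : 0 ≤ C) (hh : ∀ j, ‖h j‖ ≤ C)
    (A : Matrix (Fin N) (Fin N) ℂ) : ‖weightedTrace φ h A‖ ≤ C * nhs φ A := by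
  refine (norm_weightedTrace_le_sqrt φ h A).trans ?_
  refine mul_le_mul_of_nonneg_right ?_ (nhs_nonneg φ A)
  refine Real.sqrt_le_iff.2 ⟨hC, ?_⟩
  calc (1 / (N : ℝ)) * ∑ j, ‖h j‖ ^ 2 ≤ (1 / (N : ℝ)) * ∑ _j : Fin N, C ^ 2 := by
        gcongr with j; exact hh j
    _ = (N : ℝ)⁻¹ * N * C ^ 2 := by simp [mul_assoc]
    _ ≤ 1 * C ^ 2 := by gcongr; exact inv_mul_le_one
    _ = C ^ 2 := one_mul _

lemma weightedTrace_one (A : Matrix (Fin N) (Fin N) ℂ) :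
    weightedTrace φ (fun _ => 1) A = (1 / (N : ℂ)) * A.trace := by
  rw [weightedTrace_apply, trace_eq_sum_expectation φ]; simp

lemma norm_trace_le_nhs (A : Matrix (Fin N) (Fin N) ℂ) :
    ‖(1 / (N : ℂ)) * A.trace‖ ≤ nhs φ A := by
  rw [← weightedTrace_one φ]
  simpa using norm_weightedTrace_le φ (fun _ => 1) zero_le_one (by simp) A

lemma norm_trace_mul_mul_le (A B C : Matrix (Fin N) (Fin N) ℂ) :
    ‖(1 / (N : ℂ)) * (A * B * C).trace‖ ≤ opNorm A * opNorm B * nhs φ C := by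
  refine (norm_trace_le_nhs φ _).trans ((nhs_mul_le φ _ _).trans ?_)
  gcongr
  · exact nhs_nonneg φ C
  · exact opNorm_mul_le A B

/-- `N^(-1/2) (⟨A φ_j, φ_j⟩)_{j ∈ J}`, whose norm is the quadratic mean over `J`. -/
noncomputable def expectationVec (J : Finset (Fin N)) :
    Matrix (Fin N) (Fin N) ℂ →ₗ[ℂ] EuclideanSpace ℂ J where
  toFun A := (((√(N : ℝ) : ℝ) : ℂ))⁻¹ • WithLp.toLp 2 fun j : J => expectation A (φ j)
  map_add' A B := by
    ext j; simp [expectation, mul_add]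
  map_smul' c A := by
    ext j; simp [expectation, mul_left_comm]

lemma norm_expectationVec_sq (J : Finset (Fin N)) (A : Matrix (Fin N) (Fin N) ℂ) :
    ‖expectationVec φ J A‖ ^ 2 = (1 / (N : ℝ)) * ∑ j ∈ J, ‖expectation A (φ j)‖ ^ 2 := by
  have : expectationVec φ J A
      = (((√(N : ℝ) : ℝ) : ℂ))⁻¹ • WithLp.toLp 2 fun j : J => expectation A (φ j) := rfl
  rw [this, norm_smul, mul_pow, norm_inv, Complex.norm_real, Real.norm_of_nonneg (Real.sqrt_nonneg _),
    inv_pow, Real.sq_sqrt (Nat.cast_nonneg N), EuclideanSpace.norm_sq_eq, one_div,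
    ← Finset.sum_coe_sort J]

lemma norm_expectationVec_le (J : Finset (Fin N)) (A : Matrix (Fin N) (Fin N) ℂ) :
    ‖expectationVec φ J A‖ ≤ nhs φ A := by
  refine le_of_abs_le <| abs_le_of_sq_le_sq ?_ (nhs_nonneg φ A)
  rw [norm_expectationVec_sq, nhs_sq]
  gcongr
  refine (Finset.sum_le_univ_sum_of_nonneg fun j => sq_nonneg _).trans ?_
  gcongr with j
  exact norm_expectation_le φ A j

end HilbertSchmidt

/-! ### Limits along an index set -/

lemma eventually_mem_limAlong (I : Set ℕ) : ∀ᶠ N in limAlong I, N ∈ I :=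
  mem_inf_of_right (mem_principal_self I)

lemma limAlong_le_atTop (I : Set ℕ) : limAlong I ≤ atTop := inf_le_left

lemma eventually_pos_limAlong (I : Set ℕ) : ∀ᶠ N in limAlong I, 0 < N :=
  limAlong_le_atTop I (eventually_gt_atTop 0)

/-! ### Smooth observables as elements of `L²` -/

section Observables

variable {d : ℕ} {M : Type*} [TopologicalSpace M] [CompactSpace M]
  [ChartedSpace (EuclideanSpace ℝ (Fin d)) M] [MeasurableSpace M] [BorelSpace M]
  (μ : Measure M) [IsProbabilityMeasure μ]

lemma smoothFunctions_continuous (a : smoothFunctions d M) : Continuous (a : M → ℂ) :=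
  ContMDiff.continuous (show ContMDiff (𝓡 d) 𝓘(ℝ, ℂ) ∞ (a : M → ℂ) from a.2)

lemma smoothFunctions_memLp (a : smoothFunctions d M) : MemLp (a : M → ℂ) 2 μ := by
  obtain ⟨C, hC⟩ := (isCompact_range (smoothFunctions_continuous a)).isBounded.exists_norm_le
  exact MemLp.of_bound (smoothFunctions_continuous a).aestronglyMeasurable C
    (Eventually.of_forall fun x => hC _ ⟨x, rfl⟩)

/-- The class of a smooth function in `L²(μ)`. -/
noncomputable def toL2 : smoothFunctions d M →ₗ[ℂ] Lp ℂ 2 μ where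
  toFun a := (smoothFunctions_memLp μ a).toLp (a : M → ℂ)
  map_add' _ _ := rfl
  map_smul' _ _ := rfl

lemma coeFn_toL2 (a : smoothFunctions d M) : toL2 μ a =ᵐ[μ] (a : M → ℂ) := 
  MemLp.coeFn_toLp (smoothFunctions_memLp μ a)

lemma inner_toL2 (f : Lp ℂ 2 μ) (a : smoothFunctions d M) :
    inner ℂ f (toL2 μ a) = ∫ x, (a : M → ℂ) x * star (f x) ∂μ := by
  rw [L2.inner_def]
  refine integral_congr_ae ?_
  filter_upwards [coeFn_toL2 μ a] with x hx
  rw [hx]; rfl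

lemma norm_toL2_sq (a : smoothFunctions d M) :
    ((‖toL2 μ a‖ : ℂ)) ^ 2 = ∫ x, ((star a * a : smoothFunctions d M) : M → ℂ) x ∂μ := by
  have h := inner_self_eq_norm_sq_to_K (𝕜 := ℂ) (toL2 μ a)
  rw [inner_toL2] at h
  refine h.symm.trans (integral_congr_ae ?_)
  filter_upwards [coeFn_toL2 μ a] with x hx
  rw [hx, mul_comm]; rfl

lemma norm_toL2_one : ‖toL2 μ (1 : smoothFunctions d M)‖ = 1 := by
  have h : ((‖toL2 μ (1 : smoothFunctions d M)‖ : ℂ)) ^ 2 = 1 := by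
    rw [norm_toL2_sq]; simp
  exact (pow_eq_one_iff_of_nonneg (norm_nonneg _) two_ne_zero).1 (by exact_mod_cast h)

/-! ### Hilbert–Schmidt asymptotics of observables -/

variable {μ} {I : Set ℕ} {Op : (N : ℕ) → smoothFunctions d M →ₗ[ℂ] Matrix (Fin N) (Fin N) ℂ}
  (φ : (N : ℕ) → OrthonormalBasis (Fin N) ℂ (EuclideanSpace ℂ (Fin N)))

/-- The error may contain `x` itself because no a priori bound on the quantised observable is
assumed: the quadratic left side dominates the linear error and forces boundedness first. -/
lemma tendsto_sq_of_abs_sub_le {F : Filter ℕ} {x e e' : ℕ → ℝ} {t : ℕ → ℂ} {l : ℝ} (hl : 0 ≤ l)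
    (hx : ∀ N, 0 ≤ x N) (he : Tendsto e F (𝓝 0)) (he' : Tendsto e' F (𝓝 0))
    (ht : Tendsto t F (𝓝 (l : ℂ))) (h : ∀ N, ‖(x N : ℂ) ^ 2 - t N‖ ≤ e N * x N + e' N) :
    Tendsto (fun N => x N ^ 2) F (𝓝 l) := by
  -- Eventually `x² < (l + 1) + x + 1`, which is impossible once `x > l + 3`.
  have hb : ∀ᶠ N in F, x N ≤ l + 3 := by
    have hn : Tendsto (fun N => ‖t N‖) F (𝓝 l) := by
      simpa [abs_of_nonneg hl] using ht.norm
    filter_upwards [he.eventually_lt_const zero_lt_one, he'.eventually_lt_const zero_lt_one,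
      hn.eventually_lt_const (lt_add_one l)] with N h1 h2 h3
    have h4 : x N ^ 2 ≤ ‖t N‖ + (e N * x N + e' N) := by
      have := norm_le_norm_add_norm_sub' ((x N : ℂ) ^ 2) (t N)
      rw [norm_pow, Complex.norm_real, Real.norm_of_nonneg (hx N)] at this
      linarith [h N]
    by_contra! hc
    nlinarith [hx N]
  have h0 : Tendsto (fun N => (x N : ℂ) ^ 2 - t N) F (𝓝 0) := by
    refine squeeze_zero_norm' ?_ (a := fun N => |e N| * (l + 3) + e' N) ?_
    · filter_upwards [hb] with N hN
      refine (h N).trans ?_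
      gcongr ?_ + _
      exact (mul_le_mul_of_nonneg_right (le_abs_self _) (hx N)).trans
        (mul_le_mul_of_nonneg_left hN (abs_nonneg _))
    · simpa using (he.abs.mul_const (l + 3)).add he'
  have h1 : Tendsto (fun N => (x N : ℂ) ^ 2) F (𝓝 (l : ℂ)) := by simpa using h0.add ht
  exact_mod_cast (Complex.continuous_re.tendsto _).comp h1 |>.congr fun N => by
    simp [← Complex.ofReal_pow]

/-- The trace of `A†A` is compared with that of `Op(ā a)`. Replacing `A†` by `Op(ā)` costs an
operator-norm error times the unknown norm of `A`; the product rule costs an error tending to zero.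
-/
lemma tendsto_nhs_sq (hOp : ObservableCorrespondence μ I Op) (a : smoothFunctions d M) :
    Tendsto (fun N => nhs (φ N) (Op N a) ^ 2) (limAlong I) (𝓝 (‖toL2 μ a‖ ^ 2)) := by
  refine tendsto_sq_of_abs_sub_le (sq_nonneg _) (fun N => nhs_nonneg _ _)
    (hOp.conj a) (hOp.mul (star a) a) (t := fun N => (1 / (N : ℂ)) * (Op N (star a * a)).trace)
    ?_ ?_
  · have := hOp.trace (star a * a)
    rw [← norm_toL2_sq] at this
    simpa using this
  · intro N
    have : (nhs (φ N) (Op N a) : ℂ) ^ 2 - (1 / (N : ℂ)) * (Op N (star a * a)).trace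
        = -((1 / (N : ℂ)) * ((Op N (star a) - (Op N a)ᴴ) * Op N a).trace)
          + (1 / (N : ℂ)) * (Op N (star a) * Op N a - Op N (star a * a)).trace := by
      rw [nhs_sq_eq_trace, sub_mul, Matrix.trace_sub, Matrix.trace_sub]; ring
    rw [this]
    refine (norm_add_le _ _).trans (add_le_add ?_ ?_)
    · rw [norm_neg]
      exact (norm_trace_le_nhs (φ N) _).trans (nhs_mul_le _ _ _)
    · exact (norm_trace_le_nhs (φ N) _).trans (nhs_le_opNorm _ _)

lemma tendsto_nhs (hOp : ObservableCorrespondence μ I Op) (a : smoothFunctions d M) :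
    Tendsto (fun N => nhs (φ N) (Op N a)) (limAlong I) (𝓝 ‖toL2 μ a‖) := by
  have := (tendsto_nhs_sq φ hOp a).sqrt
  simpa [Real.sqrt_sq, nhs_nonneg] using this

/-- `Op(1)` is not assumed to be the identity. Expanding the square of the distance gives the limit
`1 - 1 - 1 + 1 = 0`. -/
lemma tendsto_nhs_one_sub (hOp : ObservableCorrespondence μ I Op) :
    Tendsto (fun N => nhs (φ N) (Op N 1 - 1)) (limAlong I) (𝓝 0) := by
  have hsq : Tendsto (fun N => (nhs (φ N) (Op N 1 - 1) : ℂ) ^ 2) (limAlong I) (𝓝 0) := by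
    have h1 : Tendsto (fun N => (nhs (φ N) (Op N 1) : ℂ) ^ 2) (limAlong I) (𝓝 1) := by
      have h := tendsto_nhs_sq φ hOp 1
      rw [norm_toL2_one, one_pow] at h
      exact_mod_cast (Complex.continuous_ofReal.tendsto _).comp h
    have h2 : Tendsto (fun N : ℕ => (1 / (N : ℂ)) * (Op N 1).trace) (limAlong I) (𝓝 1) := by
      simpa using hOp.trace 1
    have h3 : Tendsto (fun N : ℕ => (1 / (N : ℂ)) * ((Op N 1)ᴴ).trace) (limAlong I) (𝓝 1) := by
      have := (Complex.continuous_conj.tendsto _).comp h2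
      simpa [Matrix.trace_conjTranspose, Function.comp_def] using this
    have h4 := ((h1.sub h2).sub h3).add_const 1
    have e : (1 : ℂ) - 1 - 1 + 1 = 0 := by ring
    rw [e] at h4
    refine h4.congr' ?_
    filter_upwards [eventually_pos_limAlong I] with N hN
    have hN' : (N : ℂ) ≠ 0 := by exact_mod_cast hN.ne'
    rw [nhs_sq_eq_trace, nhs_sq_eq_trace]
    simp only [Matrix.conjTranspose_sub, Matrix.conjTranspose_one, sub_mul, mul_sub, one_mul,
      mul_one, Matrix.trace_sub, Matrix.trace_one, Fintype.card_fin]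
    field_simp
    ring
  have h := (Complex.continuous_re.tendsto _).comp hsq
  have h' : Tendsto (fun N => nhs (φ N) (Op N 1 - 1) ^ 2) (limAlong I) (𝓝 0) := by
    simpa [Function.comp_def, ← Complex.ofReal_pow] using h
  simpa [Real.sqrt_sq, nhs_nonneg] using h'.sqrt

end Observables

/-! ### Observables that are negligible for a family of seminorms -/

section Negligible

variable {d : ℕ} {M : Type*} [TopologicalSpace M] [CompactSpace M]
  [ChartedSpace (EuclideanSpace ℝ (Fin d)) M] [MeasurableSpace M] [BorelSpace M]
  {μ : Measure M} [IsProbabilityMeasure μ]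
  {I : Set ℕ} {Op : (N : ℕ) → smoothFunctions d M →ₗ[ℂ] Matrix (Fin N) (Fin N) ℂ}
  {φ : (N : ℕ) → OrthonormalBasis (Fin N) ℂ (EuclideanSpace ℂ (Fin N))}

/-- The observables along which a sequence of seminorms tends to zero. -/
def nullObservables (I : Set ℕ) (p : ℕ → Seminorm ℂ (smoothFunctions d M)) :
    Submodule ℂ (smoothFunctions d M) where
  carrier := {a | Tendsto (fun N => p N a) (limAlong I) (𝓝 0)}
  add_mem' {a b} ha hb := by
    refine squeeze_zero (fun N => apply_nonneg _ _) (fun N => map_add_le_add (p N) a b) ?_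
    simpa using Tendsto.add ha hb
  zero_mem' := by simp [tendsto_const_nhds]
  smul_mem' c a ha := by
    have : Tendsto (fun N => ‖c‖ * p N a) (limAlong I) (𝓝 (‖c‖ * 0)) := Tendsto.const_mul _ ha
    simpa [map_smul_eq_mul] using this

lemma mem_nullObservables {p : ℕ → Seminorm ℂ (smoothFunctions d M)} {a : smoothFunctions d M} :
    a ∈ nullObservables I p ↔ Tendsto (fun N => p N a) (limAlong I) (𝓝 0) := Iff.rfl

/-- The `L²`-closure of the negligible observables. -/
noncomputable def nullClosure (μ : Measure M) [IsProbabilityMeasure μ] (I : Set ℕ)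
    (p : ℕ → Seminorm ℂ (smoothFunctions d M)) : Submodule ℂ (Lp ℂ 2 μ) :=
  ((nullObservables I p).map (toL2 μ)).topologicalClosure

lemma mem_topologicalClosure_of_forall_inner {E : Type*} [NormedAddCommGroup E]
    [InnerProductSpace ℂ E] [CompleteSpace E] {K : Submodule ℂ E} {f : E}
    (h : ∀ g : E, (∀ u ∈ K, inner ℂ g u = 0) → inner ℂ g f = 0) : f ∈ K.topologicalClosure := by
  rw [← Submodule.orthogonal_orthogonal_eq_closure, Submodule.mem_orthogonal]
  exact fun g hg => h g fun u hu => Submodule.inner_left_of_mem_orthogonal hu hg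

lemma mem_nullClosure_of_forall_inner {p : ℕ → Seminorm ℂ (smoothFunctions d M)} {f : Lp ℂ 2 μ}
    (h : ∀ g : Lp ℂ 2 μ, (∀ b ∈ nullObservables I p, inner ℂ g (toL2 μ b) = 0) →
      inner ℂ g f = 0) : f ∈ nullClosure μ I p :=
  mem_topologicalClosure_of_forall_inner fun g hg =>
    h g fun _ hb => hg _ (Submodule.mem_map_of_mem hb)

/-- Seminorms dominated by the normalised Hilbert–Schmidt norm of the quantised observable. -/
def HSBounded (Op : (N : ℕ) → smoothFunctions d M →ₗ[ℂ] Matrix (Fin N) (Fin N) ℂ)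
    (φ : (N : ℕ) → OrthonormalBasis (Fin N) ℂ (EuclideanSpace ℂ (Fin N)))
    (p : ℕ → Seminorm ℂ (smoothFunctions d M)) (C : ℝ) : Prop :=
  ∀ N a, p N a ≤ C * nhs (φ N) (Op N a)

/-- Approximate `f` by a negligible `b` and split `c = (c - b) + b`. The radius `κ` is fixed before
`c`, and `f` need not be smooth; this is what allows indicator functions later. -/
lemma HSBounded.eventually_lt (hOp : ObservableCorrespondence μ I Op)
    {p : ℕ → Seminorm ℂ (smoothFunctions d M)} {C : ℝ} (hp : HSBounded Op φ p C)
    {f : Lp ℂ 2 μ} (hf : f ∈ nullClosure μ I p) {ε : ℝ} (hε : 0 < ε) :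
    ∃ κ > 0, ∀ c : smoothFunctions d M, ‖toL2 μ c - f‖ < κ → ∀ᶠ N in limAlong I, p N c < ε := by
  have hC : 0 < |C| + 1 := by positivity
  obtain ⟨_, ⟨b, hb, rfl⟩, hbf⟩ := Metric.mem_closure_iff.1 hf (ε / (4 * (|C| + 1))) (by positivity)
  refine ⟨ε / (4 * (|C| + 1)), by positivity, fun c hc => ?_⟩
  have hcb : ‖toL2 μ (c - b)‖ < ε / (2 * (|C| + 1)) := by
    rw [map_sub]
    calc ‖toL2 μ c - toL2 μ b‖ ≤ ‖toL2 μ c - f‖ + ‖f - toL2 μ b‖ := norm_sub_le_norm_sub_add_norm_sub ..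
      _ < ε / (4 * (|C| + 1)) + ε / (4 * (|C| + 1)) := by
          rw [dist_eq_norm] at hbf; exact add_lt_add hc hbf
      _ = _ := by field_simp; ring
  filter_upwards [(tendsto_nhs φ hOp (c - b)).eventually_lt_const hcb,
    (mem_nullObservables.1 hb).eventually_lt_const (half_pos hε)] with N h1 h2
  have h3 : p N c ≤ p N (c - b) + p N b := by simpa using map_add_le_add (p N) (c - b) b
  have h4 : p N (c - b) ≤ (|C| + 1) * nhs (φ N) (Op N (c - b)) :=
    (hp N _).trans (mul_le_mul_of_nonneg_right (by linarith [le_abs_self C]) (nhs_nonneg _ _))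
  have h5 : (|C| + 1) * nhs (φ N) (Op N (c - b)) < ε / 2 := by
    rw [← lt_div_iff₀' hC]
    refine h1.trans_eq ?_
    field_simp
  linarith

lemma HSBounded.mem_nullObservables (hOp : ObservableCorrespondence μ I Op)
    {p : ℕ → Seminorm ℂ (smoothFunctions d M)} {C : ℝ} (hp : HSBounded Op φ p C)
    {a : smoothFunctions d M} (ha : toL2 μ a ∈ nullClosure μ I p) : a ∈ nullObservables I p := by
  refine tendsto_order.2 ⟨fun r hr => ?_, fun r hr => ?_⟩
  · exact Eventually.of_forall fun N => hr.trans_le (apply_nonneg _ _)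
  · obtain ⟨κ, hκ, h⟩ := hp.eventually_lt hOp ha hr
    exact h a (by simpa using hκ)

end Negligible

/-! ### Geometry of piecewise smooth maps -/

lemma secondCountableTopology_of_charted (d : ℕ) (M : Type*) [TopologicalSpace M] [CompactSpace M]
    [ChartedSpace (EuclideanSpace ℝ (Fin d)) M] : SecondCountableTopology M :=
  ChartedSpace.secondCountable_of_sigmaCompact (EuclideanSpace ℝ (Fin d)) M

section Geometry

variable {d : ℕ} {M : Type*} [TopologicalSpace M] [CompactSpace M] [T2Space M]
  [ChartedSpace (EuclideanSpace ℝ (Fin d)) M] [IsManifold (𝓡 d) ∞ M]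
  [MeasurableSpace M] [BorelSpace M]
  {μ : Measure M} [IsProbabilityMeasure μ]

/-- In top dimension the factor `(2ε)^0` is `1`, and every closed thickening contains the closure.
-/
lemma volume_closure_eq_zero_of_upperMinkowskiContent {S : Set (EuclideanSpace ℝ (Fin d))}
    (hS : upperMinkowskiContent (d : ℝ) S = 0) : volume (closure S) = 0 := by
  rw [← nonpos_iff_eq_zero, ← hS]
  refine le_limsup_of_frequently_le (Eventually.frequently ?_)
  filter_upwards with ε
  simpa using measure_mono (Metric.closure_subset_cthickening ε S)

lemma MinkowskiContentZero.measure_closure_eq_zero (hμ : AbsContLebesgue d μ) {S : Set M}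
    (hS : MinkowskiContentZero d S) : μ (closure S) = 0 := by
  have := secondCountableTopology_of_charted d M
  refine measure_null_of_locally_null _ fun x _ => ?_
  set e := chartAt (EuclideanSpace ℝ (Fin d)) x
  have he : e ∈ atlas (EuclideanSpace ℝ (Fin d)) M := chart_mem_atlas _ x
  refine ⟨closure S ∩ e.source, ?_, ?_⟩
  · exact inter_mem self_mem_nhdsWithin
      (mem_nhdsWithin_of_mem_nhds (e.open_source.mem_nhds (mem_chart_source _ x)))
  · refine measure_mono_null ?_ (hμ e he _ (volume_closure_eq_zero_of_upperMinkowskiContent (hS e he)))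
    rintro y ⟨hyS, hy⟩
    refine ⟨hy, ?_⟩
    rw [Set.mem_preimage, mem_closure_iff_clusterPt]
    have h1 : y ∈ closure (S ∩ e.source) := by
      rw [Set.inter_comm]
      exact e.open_source.inter_closure ⟨hy, hyS⟩
    rw [← mem_closure_iff_clusterPt]
    exact ((e.continuousAt hy).continuousWithinAt (s := S ∩ e.source)).mem_closure_image h1

variable {Φ : Equiv.Perm M} {𝒰 : ℕ → Set M}

lemma isOpen_continuityDomain : IsOpen (continuityDomain 𝒰) := isClosed_closure.isOpen_compl

lemma IsPiecewiseSmooth.measure_compl_continuityDomain (hΦ : IsPiecewiseSmooth d Φ 𝒰)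
    (hμ : AbsContLebesgue d μ) : μ (continuityDomain 𝒰)ᶜ = 0 := by
  rw [continuityDomain, compl_compl]
  simpa using hΦ.boundary.measure_closure_eq_zero hμ

/-- The connected component of `x` in the continuity domain is open, hence meets some dense piece `𝒰
i`. It avoids the frontier of that piece, so being connected it lies inside the piece. -/
lemma IsPiecewiseSmooth.exists_mem (hΦ : IsPiecewiseSmooth d Φ 𝒰) {x : M}
    (hx : x ∈ continuityDomain 𝒰) : ∃ i, x ∈ 𝒰 i := by
  have := ChartedSpace.locallyConnectedSpace (EuclideanSpace ℝ (Fin d)) M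
  set V := connectedComponentIn (continuityDomain 𝒰) x
  have hVo : IsOpen V := isOpen_continuityDomain.connectedComponentIn
  have hxV : x ∈ V := mem_connectedComponentIn hx
  have hxc : x ∈ closure (⋃ i, 𝒰 i) := hΦ.dense ▸ Set.mem_univ x
  obtain ⟨y, hyV, hy⟩ := mem_closure_iff.1 hxc V hVo hxV
  obtain ⟨i, hi⟩ := Set.mem_iUnion.1 hy
  refine ⟨i, ?_⟩
  refine isPreconnected_connectedComponentIn.subset_left_of_subset_union (hΦ.isOpen i)
    (isClosed_closure (s := 𝒰 i)).isOpen_compl ?_ ?_ ⟨y, hyV, hi⟩ hxV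
  · exact Set.disjoint_compl_right_iff_subset.2 subset_closure
  · intro z hz
    by_cases hzi : z ∈ 𝒰 i
    · exact Or.inl hzi
    · refine Or.inr fun hzc => connectedComponentIn_subset _ _ hz ?_
      refine subset_closure (Set.mem_iUnion.2 ⟨i, hzc, ?_⟩)
      rwa [(hΦ.isOpen i).interior_eq]

lemma IsPiecewiseSmooth.contMDiffAt (hΦ : IsPiecewiseSmooth d Φ 𝒰) {x : M}
    (hx : x ∈ continuityDomain 𝒰) : ContMDiffAt (𝓡 d) (𝓡 d) ∞ Φ x := by
  obtain ⟨i, hi⟩ := hΦ.exists_mem hx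
  obtain ⟨Ψ, hΨ, hs⟩ := hΦ.smooth i
  have hn := (hΦ.isOpen i).mem_nhds hi
  exact ((hs.mono subset_closure).contMDiffAt hn).congr_of_eventuallyEq
    (hΨ.symm.eventuallyEq_of_mem hn)

/-- The set of continuity points near which `Φ` is an open map. -/
def regularDomain (Φ : M → M) (𝒰 : ℕ → Set M) : Set M :=
  continuityDomain 𝒰 ∩ {x | ∀ᶠ y in 𝓝 x, map Φ (𝓝 y) = 𝓝 (Φ y)}

lemma isOpen_regularDomain {Φ : M → M} : IsOpen (regularDomain Φ 𝒰) :=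
  isOpen_continuityDomain.inter isOpen_setOfPred_eventually_nhds

lemma eventually_map_nhds_eq_of_det_ne_zero {E : Type*} [NormedAddCommGroup E] [NormedSpace ℝ E]
    [FiniteDimensional ℝ E] {f : E → E} {x : E} (hf : ContDiffAt ℝ ∞ f x)
    (hx : (fderiv ℝ f x).det ≠ 0) : ∀ᶠ y in 𝓝 x, map f (𝓝 y) = 𝓝 (f y) := by
  have h := hf.hasStrictFDerivAt (by simp)
  rw [← (fderiv ℝ f x).coe_toContinuousLinearEquivOfDetNeZero hx] at h
  have hs := h.mem_toOpenPartialHomeomorph_source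
  filter_upwards [(h.toOpenPartialHomeomorph f).open_source.mem_nhds hs] with y hy
  exact (h.toOpenPartialHomeomorph f).map_nhds_eq hy

/-- Sard's theorem in equal dimensions: in charts the critical points have a Lebesgue-null image.
Since `μ` is absolutely continuous and `Φ` preserves it, the preimage of that image is null and
contains the critical points. Elsewhere the inverse function theorem makes `Φ` open. -/
lemma IsPiecewiseSmooth.measure_compl_regularDomain (hΦ : IsPiecewiseSmooth d Φ 𝒰)
    (hμ : AbsContLebesgue d μ) (hΦμ : MeasurePreserving Φ μ μ) : μ (regularDomain Φ 𝒰)ᶜ = 0 := by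
  have := secondCountableTopology_of_charted d M
  suffices h : μ (continuityDomain 𝒰 \ regularDomain Φ 𝒰) = 0 by
    refine measure_mono_null ?_ (measure_union_null (hΦ.measure_compl_continuityDomain hμ) h)
    intro x hx
    by_cases hc : x ∈ continuityDomain 𝒰
    · exact Or.inr ⟨hc, hx⟩
    · exact Or.inl hc
  refine measure_null_of_locally_null _ fun x₀ hx₀ => ?_
  set e := chartAt (EuclideanSpace ℝ (Fin d)) x₀ with he_def
  set e' := chartAt (EuclideanSpace ℝ (Fin d)) (Φ x₀) with he'_def
  set f : EuclideanSpace ℝ (Fin d) → EuclideanSpace ℝ (Fin d) := e' ∘ Φ ∘ e.symm with hf_def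
  set V := continuityDomain 𝒰 ∩ e.source ∩ Φ ⁻¹' e'.source with hV_def
  have hVn : ∀ y ∈ V, V ∈ 𝓝 y := fun y hy =>
    inter_mem (inter_mem (isOpen_continuityDomain.mem_nhds hy.1.1)
      (e.open_source.mem_nhds hy.1.2))
      ((hΦ.contMDiffAt hy.1.1).continuousAt.preimage_mem_nhds (e'.open_source.mem_nhds hy.2))
  have hx₀V : x₀ ∈ V := ⟨⟨hx₀.1, mem_chart_source _ _⟩, mem_chart_source _ _⟩
  have hf : ∀ y ∈ V, ContDiffAt ℝ ∞ f (e y) := by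
    intro y hy
    have h := (contMDiffAt_iff_of_mem_source (I := 𝓡 d) (I' := 𝓡 d) hy.1.2 hy.2).1
      (hΦ.contMDiffAt hy.1.1)
    have h2 := h.2
    simp only [modelWithCornersSelf_coe, Set.range_id, contDiffWithinAt_univ] at h2
    simpa [extChartAt, hf_def] using h2
  set crit := {y ∈ V | (fderiv ℝ f (e y)).det = 0} with hcrit
  have hnull : μ crit = 0 := by
    have h1 : volume (f '' (e '' crit)) = 0 := by
      refine addHaar_image_eq_zero_of_det_fderivWithin_eq_zero volume (f' := fderiv ℝ f) ?_ ?_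
      · rintro _ ⟨y, hy, rfl⟩
        exact ((hf y hy.1).differentiableAt (by simp)).hasFDerivAt.hasFDerivWithinAt
      · rintro _ ⟨y, hy, rfl⟩
        exact hy.2
    have h2 := hμ e' (chart_mem_atlas _ _) _ h1
    refine measure_mono_null ?_ (hΦμ.quasiMeasurePreserving.preimage_null h2)
    intro y hy
    refine ⟨hy.1.2, ?_⟩
    refine ⟨e y, ⟨y, hy, rfl⟩, ?_⟩
    simp [hf_def, e.left_inv hy.1.1.2]
  refine ⟨crit, ?_, hnull⟩
  filter_upwards [self_mem_nhdsWithin, mem_nhdsWithin_of_mem_nhds (hVn x₀ hx₀V)] with y hy hyV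
  refine ⟨hyV, ?_⟩
  by_contra hdet
  refine hy.2 ⟨hy.1, ?_⟩
  have h1 := (e.continuousAt hyV.1.2).eventually
    (eventually_map_nhds_eq_of_det_ne_zero (hf y hyV) hdet)
  filter_upwards [h1, hVn y hyV] with z hz hzV
  have h2 : Φ =ᶠ[𝓝 z] e'.symm ∘ f ∘ e := by
    filter_upwards [hVn z hzV] with w hw
    have h3 : e'.symm (e' (Φ w)) = Φ w := e'.left_inv hw.2
    simp only [hf_def, Function.comp_apply, e.left_inv hw.1.2, h3]
  have h4 : f (e z) = e' (Φ z) := by simp [hf_def, e.left_inv hzV.1.2]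
  rw [Filter.map_congr h2, ← Filter.map_map, ← Filter.map_map, e.map_nhds_eq hzV.1.2, hz, h4,
    ← e'.map_nhds_eq hzV.2, Filter.map_map]
  have h5 : e'.symm ∘ e' =ᶠ[𝓝 (Φ z)] id := by
    filter_upwards [e'.open_source.mem_nhds hzV.2] with w hw using e'.left_inv hw
  rw [Filter.map_congr h5, Filter.map_id]

end Geometry

/-! ### Egorov's theorem for iterates -/

section Egorov

variable {d : ℕ} {M : Type*} [TopologicalSpace M] [CompactSpace M] [T2Space M]
  [ChartedSpace (EuclideanSpace ℝ (Fin d)) M] [IsManifold (𝓡 d) ∞ M]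
  [MeasurableSpace M] [BorelSpace M]
  {μ : Measure M} [IsProbabilityMeasure μ] {Φ : Equiv.Perm M} {𝒰 : ℕ → Set M}
  {I : Set ℕ} {Op : (N : ℕ) → smoothFunctions d M →ₗ[ℂ] Matrix (Fin N) (Fin N) ℂ}
  {U : (N : ℕ) → Matrix.unitaryGroup (Fin N) ℂ}

lemma map_nhds_of_mem_regularDomain {x : M} (hx : x ∈ regularDomain Φ 𝒰) :
    map Φ (𝓝 x) = 𝓝 (Φ x) := hx.2.self_of_nhds

lemma continuousOn_symm_image_regularDomain :
    ContinuousOn Φ.symm (Φ '' regularDomain Φ 𝒰) := by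
  rintro _ ⟨x, hx, rfl⟩
  refine ContinuousAt.continuousWithinAt ?_
  rw [ContinuousAt, ← map_nhds_of_mem_regularDomain hx, tendsto_map'_iff]
  simp only [Function.comp_def, Equiv.symm_apply_apply]
  exact tendsto_id

lemma isOpen_image_of_subset_regularDomain {S : Set M} (hS : IsOpen S)
    (hSr : S ⊆ regularDomain Φ 𝒰) : IsOpen (Φ '' S) := by
  rw [isOpen_iff_mem_nhds]
  rintro _ ⟨x, hx, rfl⟩
  rw [← map_nhds_of_mem_regularDomain (hSr hx)]
  exact image_mem_map (hS.mem_nhds hx)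

lemma measure_compl_image_eq_zero (hΦμ : MeasurePreserving Φ μ μ) {S : Set M} (hS : IsOpen S)
    (hSr : S ⊆ regularDomain Φ 𝒰) (h0 : μ Sᶜ = 0) : μ (Φ '' S)ᶜ = 0 := by
  have hm : MeasurableSet (Φ '' S)ᶜ :=
    (isOpen_image_of_subset_regularDomain hS hSr).measurableSet.compl
  rw [← hΦμ.measure_preimage hm.nullMeasurableSet, Set.preimage_compl,
    Set.preimage_image_eq S Φ.injective, h0]

/-- Since `Φ⁻¹` is continuous on the image of the regular domain, the preimage of the compact
support of `c` is compact, hence closed. So `c ∘ Φ` is smooth on it and locally zero off it. -/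
lemma IsPiecewiseSmooth.exists_pullback (hΦ : IsPiecewiseSmooth d Φ 𝒰) {c : smoothFunctions d M}
    (hc : tsupport (c : M → ℂ) ⊆ Φ '' regularDomain Φ 𝒰) :
    ∃ b : smoothFunctions d M, (b : M → ℂ) = (c : M → ℂ) ∘ Φ ∧
      tsupport (b : M → ℂ) ⊆ Φ ⁻¹' tsupport (c : M → ℂ) := by
  set K := Φ ⁻¹' tsupport (c : M → ℂ) with hK
  have hKr : K ⊆ regularDomain Φ 𝒰 := by
    rintro x hx
    obtain ⟨y, hy, hyx⟩ := hc hx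
    rwa [← Φ.injective hyx]
  have hKc : IsClosed K := by
    have : K = Φ.symm '' tsupport (c : M → ℂ) := by
      rw [hK, Equiv.image_symm_eq_preimage]
    rw [this]
    exact ((isClosed_tsupport _).isCompact.image_of_continuousOn
      (continuousOn_symm_image_regularDomain.mono hc)).isClosed
  refine ⟨⟨(c : M → ℂ) ∘ Φ, fun x => ?_⟩, rfl, closure_minimal ?_ hKc⟩
  · by_cases hx : x ∈ K
    · exact ContMDiffAt.comp x (show ContMDiff (𝓡 d) 𝓘(ℝ, ℂ) ∞ (c : M → ℂ) from c.2).contMDiffAt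
        (hΦ.contMDiffAt (hKr hx).1)
    · refine (contMDiffAt_const (c := (0 : ℂ))).congr_of_eventuallyEq ?_
      filter_upwards [hKc.isOpen_compl.mem_nhds hx] with y hy
      exact image_eq_zero_of_notMem_tsupport (f := (c : M → ℂ)) hy
  · intro x hx
    exact subset_tsupport _ hx

lemma opNorm_conj_le {N : ℕ} (V : Matrix.unitaryGroup (Fin N) ℂ) (A : Matrix (Fin N) (Fin N) ℂ) :
    opNorm ((V⁻¹ : Matrix.unitaryGroup (Fin N) ℂ).1 * A * V.1) ≤ opNorm A := by
  refine (opNorm_mul_le _ _).trans ?_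
  refine (mul_le_of_le_one_right (opNorm_nonneg _) (opNorm_unitary_le V)).trans ?_
  refine (opNorm_mul_le _ _).trans ?_
  exact mul_le_of_le_one_left (opNorm_nonneg _) (opNorm_unitary_le V⁻¹)

/-- Egorov's theorem for `Φ^n`, for observables supported in an open set of full measure. -/
lemma exists_isOpen_egorov (hΦ : IsPiecewiseSmooth d Φ 𝒰) (hμ : AbsContLebesgue d μ)
    (hΦμ : MeasurePreserving Φ μ μ) (hU : MapCorrespondence Φ 𝒰 I Op U) (n : ℕ) :
    ∃ R : Set M, IsOpen R ∧ μ Rᶜ = 0 ∧ ∀ c : smoothFunctions d M, tsupport (c : M → ℂ) ⊆ R →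
      ∃ b : smoothFunctions d M, (b : M → ℂ) = (c : M → ℂ) ∘ Φ^[n] ∧
        SemiclassicalEquiv I (fun N => ((U N ^ n)⁻¹ : Matrix.unitaryGroup (Fin N) ℂ).1 * Op N c *
          (U N ^ n).1) (fun N => Op N b) := by
  induction n with
  | zero =>
    refine ⟨Set.univ, isOpen_univ, by simp, fun c _ => ⟨c, rfl, ?_⟩⟩
    simp [SemiclassicalEquiv, opNorm, tendsto_const_nhds]
  | succ n ih =>
    obtain ⟨R, hRo, hR0, hR⟩ := ih
    have hreg := hΦ.measure_compl_regularDomain hμ hΦμ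
    have ho : IsOpen (regularDomain Φ 𝒰 ∩ R) := isOpen_regularDomain.inter hRo
    -- With this choice both `c` and `c ∘ Φ` are supported in the continuity domain, and `c ∘ Φ` is
    -- supported in `R`, where the induction hypothesis applies.
    refine ⟨regularDomain Φ 𝒰 ∩ Φ '' (regularDomain Φ 𝒰 ∩ R),
      isOpen_regularDomain.inter (isOpen_image_of_subset_regularDomain ho Set.inter_subset_left),
      ?_, fun c hc => ?_⟩
    · rw [Set.compl_inter]
      refine measure_union_null hreg
        (measure_compl_image_eq_zero hΦμ ho Set.inter_subset_left ?_)
      rw [Set.compl_inter]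
      exact measure_union_null hreg hR0
    · obtain ⟨b₁, hb₁, hb₁s⟩ := hΦ.exists_pullback
        (fun x hx => Set.image_mono Set.inter_subset_left (hc hx).2)
      have hb₁R : tsupport (b₁ : M → ℂ) ⊆ regularDomain Φ 𝒰 ∩ R := fun x hx => by
        obtain ⟨y, hy, hyx⟩ := (hc (hb₁s hx)).2
        rwa [← Φ.injective hyx]
      obtain ⟨b, hb, hbE⟩ := hR b₁ fun x hx => (hb₁R hx).2
      refine ⟨b, by rw [hb, hb₁, Function.iterate_succ', Function.comp_assoc], ?_⟩
      have h1 := hU c b₁ hb₁ (fun x hx => (hc hx).1.1) (fun x hx => (hb₁R hx).1.1)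
      have h0 := Tendsto.add h1 hbE
      rw [add_zero] at h0
      refine squeeze_zero (fun N => opNorm_nonneg _) (fun N => ?_) h0
      -- Telescoping: the one-step error conjugated by `U^n`, plus the error of the induction
      -- hypothesis for `c ∘ Φ`.
      have h2 : ((U N ^ (n + 1))⁻¹ : Matrix.unitaryGroup (Fin N) ℂ).1 * Op N c * (U N ^ (n + 1)).1
          - Op N b = ((U N ^ n)⁻¹ : Matrix.unitaryGroup (Fin N) ℂ).1 *
            (((U N)⁻¹ : Matrix.unitaryGroup (Fin N) ℂ).1 * Op N c * (U N).1 - Op N b₁) *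
              (U N ^ n).1 + (((U N ^ n)⁻¹ : Matrix.unitaryGroup (Fin N) ℂ).1 * Op N b₁ *
              (U N ^ n).1 - Op N b) := by
        have h3 : (U N ^ (n + 1)).1 = (U N).1 * (U N ^ n).1 := by rw [pow_succ']; rfl
        have h4 : ((U N ^ (n + 1))⁻¹ : Matrix.unitaryGroup (Fin N) ℂ).1
            = ((U N ^ n)⁻¹ : Matrix.unitaryGroup (Fin N) ℂ).1 *
              ((U N)⁻¹ : Matrix.unitaryGroup (Fin N) ℂ).1 := by
          rw [pow_succ', mul_inv_rev]; rfl
        rw [h3, h4, mul_sub, sub_mul]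
        simp only [mul_assoc, sub_add_sub_cancel]
      rw [h2]
      refine (opNorm_add_le _ _).trans ?_
      gcongr
      exact opNorm_conj_le (U N ^ n) _

/-! ### The smooth part of the periodic domains -/

lemma IsPiecewiseSmooth.continuousAt_iterate (hΦ : IsPiecewiseSmooth d Φ 𝒰) {k : ℕ} {x : M}
    (hx : x ∈ iterateContinuityDomain Φ 𝒰 k) : ContinuousAt Φ^[k] x := by
  induction k with
  | zero => exact continuousAt_id
  | succ k ih =>
    rw [Function.iterate_succ']
    exact (hΦ.contMDiffAt (hx k (Nat.lt_succ_self k))).continuousAt.comp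
      (ih fun i hi => hx i (hi.trans (Nat.lt_succ_self k)))

lemma IsPiecewiseSmooth.isOpen_iterateContinuityDomain (hΦ : IsPiecewiseSmooth d Φ 𝒰) (k : ℕ) :
    IsOpen (iterateContinuityDomain Φ 𝒰 k) := by
  rw [isOpen_iff_mem_nhds]
  intro x hx
  have h : ∀ i ∈ Set.Iio k, ∀ᶠ y in 𝓝 x, Φ^[i] y ∈ continuityDomain 𝒰 := fun i hi =>
    (hΦ.continuousAt_iterate fun j hj => hx j (hj.trans hi)).eventually
      (isOpen_continuityDomain.mem_nhds (hx i hi))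
  filter_upwards [(eventually_all_finite (Set.finite_Iio k)).2 h] with y hy i hi using hy i hi

lemma IsPiecewiseSmooth.measure_compl_iterateContinuityDomain (hΦ : IsPiecewiseSmooth d Φ 𝒰)
    (hμ : AbsContLebesgue d μ) (hΦμ : MeasurePreserving Φ μ μ) (k : ℕ) :
    μ (iterateContinuityDomain Φ 𝒰 k)ᶜ = 0 := by
  have h : (iterateContinuityDomain Φ 𝒰 k)ᶜ ⊆ ⋃ i, Φ^[i] ⁻¹' (continuityDomain 𝒰)ᶜ := by
    intro x hx
    simp only [iterateContinuityDomain, Set.mem_compl_iff, Set.mem_ofPred_eq, not_forall] at hx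
    obtain ⟨i, -, hi⟩ := hx
    exact Set.mem_iUnion.2 ⟨i, hi⟩
  refine measure_mono_null h (measure_iUnion_null fun i => ?_)
  exact (hΦμ.iterate i).quasiMeasurePreserving.preimage_null
    (hΦ.measure_compl_continuityDomain hμ)

/-- The points of the interior of `D` at which `Φ, …, Φ^k` are continuous. -/
def smoothCore (Φ : M → M) (𝒰 : ℕ → Set M) (D : Set M) (k : ℕ) : Set M :=
  interior D ∩ iterateContinuityDomain Φ 𝒰 k

lemma IsPiecewiseSmooth.isOpen_smoothCore (hΦ : IsPiecewiseSmooth d Φ 𝒰) (D : Set M) (k : ℕ) :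
    IsOpen (smoothCore Φ 𝒰 D k) := isOpen_interior.inter (hΦ.isOpen_iterateContinuityDomain k)

lemma IsPiecewiseSmooth.measure_diff_smoothCore (hΦ : IsPiecewiseSmooth d Φ 𝒰)
    (hμ : AbsContLebesgue d μ) (hΦμ : MeasurePreserving Φ μ μ) {D : Set M}
    (hD : MinkowskiContentZero d (frontier D)) (k : ℕ) : μ (D \ smoothCore Φ 𝒰 D k) = 0 := by
  refine measure_mono_null (t := frontier D ∪ (iterateContinuityDomain Φ 𝒰 k)ᶜ) ?_
    (measure_union_null ?_ (hΦ.measure_compl_iterateContinuityDomain hμ hΦμ k))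
  · intro x hx
    by_cases h : x ∈ interior D
    · exact Or.inr fun h' => hx.2 ⟨h, h'⟩
    · exact Or.inl ⟨subset_closure hx.1, h⟩
  · exact measure_mono_null subset_closure (hD.measure_closure_eq_zero hμ)

end Egorov

/-! ### Orthogonality to smooth functions -/

section Orthogonality

variable {d : ℕ} {M : Type*} [TopologicalSpace M] [CompactSpace M] [T2Space M]
  [ChartedSpace (EuclideanSpace ℝ (Fin d)) M] [IsManifold (𝓡 d) ∞ M]
  [MeasurableSpace M] [BorelSpace M]
  {μ : Measure M} [IsProbabilityMeasure μ]

/-- A real smooth function as an observable. -/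
def smoothOfReal (g : M → ℝ) (hg : ContMDiff (𝓡 d) 𝓘(ℝ, ℝ) ∞ g) : smoothFunctions d M :=
  ⟨fun x => (g x : ℂ), ContMDiff.comp (Complex.ofRealCLM.contDiff.contMDiff) hg⟩

lemma tsupport_smoothOfReal (g : M → ℝ) (hg : ContMDiff (𝓡 d) 𝓘(ℝ, ℝ) ∞ g) :
    tsupport (smoothOfReal g hg : M → ℂ) = tsupport g := by
  have : Function.support (smoothOfReal g hg : M → ℂ) = Function.support g := by
    ext x; simp [smoothOfReal]
  rw [tsupport, this, tsupport]

lemma integrable_mul_star (a : smoothFunctions d M) (g : Lp ℂ 2 μ) :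
    Integrable (fun x => (a : M → ℂ) x * star (g x)) μ := by
  refine (L2.integrable_inner (𝕜 := ℂ) g (toL2 μ a)).congr ?_
  filter_upwards [coeFn_toL2 μ a] with x hx
  rw [hx]; rfl

lemma ae_eq_zero_of_forall_integral_mul {F : M → ℂ} (hF : Integrable F μ) {O : Set M}
    (hO : IsOpen O) (H : ∀ b : smoothFunctions d M, tsupport (b : M → ℂ) ⊆ O →
      ∫ x, (b : M → ℂ) x * F x ∂μ = 0) :
    ∀ᵐ x ∂μ, x ∈ O → F x = 0 := by
  refine hO.ae_eq_zero_of_integral_contMDiff_smul_eq_zero (𝓡 d)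
    (hF.locallyIntegrable.locallyIntegrableOn O) fun g hg _ hgO => ?_
  simpa [smoothOfReal] using H (smoothOfReal g hg) (by rwa [tsupport_smoothOfReal])

lemma ae_eq_zero_of_forall_inner_toL2 (h : Lp ℂ 2 μ) {O : Set M} (hO : IsOpen O)
    (H : ∀ b : smoothFunctions d M, tsupport (b : M → ℂ) ⊆ O → inner ℂ h (toL2 μ b) = 0) :
    ∀ᵐ x ∂μ, x ∈ O → h x = 0 := by
  have hi : Integrable (fun x => star (h x)) μ := by
    simpa using integrable_mul_star (1 : smoothFunctions d M) h
  filter_upwards [ae_eq_zero_of_forall_integral_mul (d := d) hi hO fun b hb => by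
    rw [← inner_toL2]; exact H b hb] with x hx hxO
  simpa using hx hxO

/-- Composition with a measure preserving map, acting on `L²`. -/
noncomputable abbrev koopman {Φ : M → M} (hΦμ : MeasurePreserving Φ μ μ) :
    Lp ℂ 2 μ →ₗᵢ[ℂ] Lp ℂ 2 μ := Lp.compMeasurePreservingₗᵢ ℂ Φ hΦμ

lemma koopman_toL2 {Φ : M → M} (hΦμ : MeasurePreserving Φ μ μ) {c b : smoothFunctions d M}
    (h : (b : M → ℂ) = (c : M → ℂ) ∘ Φ) : koopman hΦμ (toL2 μ c) = toL2 μ b := by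
  have h1 : koopman hΦμ (toL2 μ c)
      = ((smoothFunctions_memLp μ c).comp_measurePreserving hΦμ).toLp _ :=
    Lp.toLp_compMeasurePreserving (smoothFunctions_memLp μ c) hΦμ
  rw [h1]
  exact MemLp.toLp_congr _ (smoothFunctions_memLp μ b) (by rw [h])

/-- Expand `‖V h - h‖²`: all four inner products equal `‖h‖²` up to sign and cancel. -/
lemma LinearIsometry.apply_eq_self_of_adjoint_apply_eq_self {E : Type*} [NormedAddCommGroup E]
    [InnerProductSpace ℂ E] [CompleteSpace E] (V : E →ₗᵢ[ℂ] E) {h : E}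
    (H : ∀ f, inner ℂ h (V f) = inner ℂ h f) : V h = h := by
  have h1 : inner ℂ (V h) h = inner ℂ h h := by
    rw [← inner_conj_symm, H h, inner_conj_symm]
  rw [← sub_eq_zero, ← inner_self_eq_zero (𝕜 := ℂ), inner_sub_left, inner_sub_right,
    inner_sub_right, V.inner_map_map, h1, H h]
  simp

/-- A vector orthogonal to all coboundaries `c - c ∘ Φ` is `Φ`-invariant. -/
lemma koopman_eq_self_of_forall_inner {Φ : M → M} (hΦμ : MeasurePreserving Φ μ μ) (h : Lp ℂ 2 μ)
    {R : Set M} (hR : IsOpen R) (hR0 : μ Rᶜ = 0)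
    (H : ∀ c : smoothFunctions d M, tsupport (c : M → ℂ) ⊆ R →
      inner ℂ h (toL2 μ c - koopman hΦμ (toL2 μ c)) = 0) : koopman hΦμ h = h := by
  set T : Lp ℂ 2 μ →L[ℂ] Lp ℂ 2 μ := (koopman hΦμ).toContinuousLinearMap
  -- Orthogonality to coboundaries directly yields invariance under the adjoint only, here tested on
  -- functions supported in the full-measure set `R`.
  have h0 : h - ContinuousLinearMap.adjoint T h = 0 := by
    rw [Lp.eq_zero_iff_ae_eq_zero]
    have := ae_eq_zero_of_forall_inner_toL2 (h - ContinuousLinearMap.adjoint T h) hR fun c hc => by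
      rw [inner_sub_left, ContinuousLinearMap.adjoint_inner_left, ← inner_sub_right]
      exact H c hc
    filter_upwards [this, measure_eq_zero_iff_ae_notMem.1 hR0] with x hx hxR
    exact hx (by simpa using hxR)
  refine LinearIsometry.apply_eq_self_of_adjoint_apply_eq_self _ fun f => ?_
  conv_rhs => rw [sub_eq_zero.1 h0, ContinuousLinearMap.adjoint_inner_left]
  rfl

end Orthogonality

/-! ### Ergodic averages of expectation values -/

section ErgodicPart

variable {d : ℕ} {M : Type*} [TopologicalSpace M] [CompactSpace M] [T2Space M]
  [ChartedSpace (EuclideanSpace ℝ (Fin d)) M] [IsManifold (𝓡 d) ∞ M]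
  [MeasurableSpace M] [BorelSpace M]
  {μ : Measure M} [IsProbabilityMeasure μ] {Φ : Equiv.Perm M} {𝒰 : ℕ → Set M}
  {I : Set ℕ} {Op : (N : ℕ) → smoothFunctions d M →ₗ[ℂ] Matrix (Fin N) (Fin N) ℂ}
  {U : (N : ℕ) → Matrix.unitaryGroup (Fin N) ℂ}
  {φ : (N : ℕ) → OrthonormalBasis (Fin N) ℂ (EuclideanSpace ℂ (Fin N))}

/-- The quadratic mean over `J_N` of the expectation values of an observable. -/
noncomputable def meanSeminorm
    (Op : (N : ℕ) → smoothFunctions d M →ₗ[ℂ] Matrix (Fin N) (Fin N) ℂ)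
    (φ : (N : ℕ) → OrthonormalBasis (Fin N) ℂ (EuclideanSpace ℂ (Fin N)))
    (J : (N : ℕ) → Finset (Fin N)) (N : ℕ) : Seminorm ℂ (smoothFunctions d M) :=
  (normSeminorm ℂ _).comp (expectationVec (φ N) (J N) ∘ₗ Op N)

lemma meanSeminorm_apply (J : (N : ℕ) → Finset (Fin N)) (N : ℕ) (a : smoothFunctions d M) :
    meanSeminorm Op φ J N a = ‖expectationVec (φ N) (J N) (Op N a)‖ := rfl

lemma hsBounded_meanSeminorm (J : (N : ℕ) → Finset (Fin N)) :
    HSBounded Op φ (meanSeminorm Op φ J) 1 := fun N a => by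
  rw [one_mul]; exact norm_expectationVec_le _ _ _

lemma mem_nullObservables_meanSeminorm (J : (N : ℕ) → Finset (Fin N)) (a : smoothFunctions d M) :
    a ∈ nullObservables I (meanSeminorm Op φ J) ↔
      Tendsto (fun N : ℕ => (1 / (N : ℝ)) * ∑ j ∈ J N, ‖expectation (Op N a) (φ N j)‖ ^ 2)
        (limAlong I) (𝓝 0) := by
  rw [mem_nullObservables]
  simp_rw [← norm_expectationVec_sq, meanSeminorm_apply]
  refine ⟨fun h => by simpa using h.pow 2, fun h => ?_⟩
  simpa [Real.sqrt_sq] using h.sqrt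

lemma expectation_conj_of_eigenvector {N : ℕ} (V : Matrix.unitaryGroup (Fin N) ℂ)
    (A : Matrix (Fin N) (Fin N) ℂ) {ψ : EuclideanSpace ℂ (Fin N)} {z : ℂ} (hz : ‖z‖ = 1)
    (h : Matrix.toEuclideanCLM (n := Fin N) (𝕜 := ℂ) V.1 ψ = z • ψ) :
    expectation ((V⁻¹ : Matrix.unitaryGroup (Fin N) ℂ).1 * A * V.1) ψ = expectation A ψ := by
  have h1 : (V⁻¹ : Matrix.unitaryGroup (Fin N) ℂ).1 = (V.1)ᴴ := rfl
  rw [expectation, expectation, h1, map_mul, map_mul, mul_apply_eq_comp, mul_apply_eq_comp,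
    toEuclideanCLM_conjTranspose, ContinuousLinearMap.adjoint_inner_right, h, map_smul,
    inner_smul_left, inner_smul_right, ← mul_assoc, Complex.conj_mul', hz]
  simp

/-- Eigenvalues have modulus one, so expectations in eigenvectors are unchanged by conjugation with
`U`; the operator-norm error in Egorov's theorem then bounds the seminorm. -/
lemma sub_mem_nullObservables_meanSeminorm (J : (N : ℕ) → Finset (Fin N))
    (hφ : ∀ N ∈ I, ∀ j, ∃ θ : ℝ, Matrix.toEuclideanCLM (n := Fin N) (𝕜 := ℂ) (U N).1 (φ N j) =
      Complex.exp (2 * Real.pi * Complex.I * θ) • φ N j) {c b : smoothFunctions d M}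
    (h : SemiclassicalEquiv I (fun N => ((U N)⁻¹ : Matrix.unitaryGroup (Fin N) ℂ).1 * Op N c *
      (U N).1) (fun N => Op N b)) : c - b ∈ nullObservables I (meanSeminorm Op φ J) := by
  refine mem_nullObservables.2 (squeeze_zero' (Eventually.of_forall fun N => apply_nonneg _ _) ?_ h)
  filter_upwards [eventually_mem_limAlong I] with N hN
  have h1 : expectationVec (φ N) (J N) (Op N c)
      = expectationVec (φ N) (J N) (((U N)⁻¹ : Matrix.unitaryGroup (Fin N) ℂ).1 * Op N c *
      (U N).1) := by
    have : ∀ j : J N, expectation (((U N)⁻¹ : Matrix.unitaryGroup (Fin N) ℂ).1 * Op N c *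
        (U N).1) (φ N j) = expectation (Op N c) (φ N j) := by
      intro j
      obtain ⟨θ, hθ⟩ := hφ N hN j
      refine expectation_conj_of_eigenvector _ _ ?_ hθ
      rw [Complex.norm_exp]; simp
    simp only [expectationVec, LinearMap.coe_mk, AddHom.coe_mk, this]
  rw [meanSeminorm_apply, map_sub, map_sub, h1, ← map_sub]
  exact (norm_expectationVec_le _ _ _).trans (nhs_le_opNorm _ _)

lemma ae_mem_core_of_frontier_null (hμ : AbsContLebesgue d μ) {D : ℕ → Set M}
    (hD : ∀ ν, MinkowskiContentZero d (frontier (D ν))) :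
    ∀ᵐ x ∂μ, ∀ ν, x ∈ D ν → x ∈ interior (D ν) := by
  rw [ae_all_iff]
  intro ν
  have : μ (frontier (D ν)) = 0 :=
    measure_mono_null subset_closure ((hD ν).measure_closure_eq_zero hμ)
  filter_upwards [measure_eq_zero_iff_ae_notMem.1 this] with x hx hxD
  by_contra h
  exact hx ⟨subset_closure hxD, h⟩

lemma nullMeasurableSet_iUnion_of_frontier (hμ : AbsContLebesgue d μ) {D : ℕ → Set M}
    (hD : ∀ ν, MinkowskiContentZero d (frontier (D ν))) :
    NullMeasurableSet (⋃ ν, D ν) μ :=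
  NullMeasurableSet.iUnion fun ν => nullMeasurableSet_of_null_frontier
    (measure_mono_null subset_closure ((hD ν).measure_closure_eq_zero hμ))

/-- Quantum ergodicity for states localised on the ergodic component. -/
theorem tendsto_variance_of_localisedOn (hμ : AbsContLebesgue d μ)
    (hΦμ : MeasurePreserving Φ μ μ) (hΦ : IsPiecewiseSmooth d Φ 𝒰)
    (hOp : ObservableCorrespondence μ I Op) (hU : MapCorrespondence Φ 𝒰 I Op U)
    {D : ℕ → Set M} (hD : ∀ ν, MinkowskiContentZero d (frontier (D ν)))
    (herg : Ergodic Φ (μ.restrict (⋃ ν, D ν)ᶜ))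
    (hφ : ∀ N ∈ I, ∀ j, ∃ θ : ℝ, Matrix.toEuclideanCLM (n := Fin N) (𝕜 := ℂ) (U N).1 (φ N j) =
      Complex.exp (2 * Real.pi * Complex.I * θ) • φ N j)
    {J : (N : ℕ) → Finset (Fin N)} (hJ : LocalisedOn I Op φ J (⋃ ν, D ν)ᶜ)
    (a : smoothFunctions d M) :
    Tendsto (fun N : ℕ => (1 / (N : ℝ)) * ∑ j ∈ J N,
        ‖expectation (Op N a) (φ N j) - ⨍ x in (⋃ ν, D ν)ᶜ, (a : M → ℂ) x ∂μ‖ ^ 2)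
      (limAlong I) (𝓝 0) := by
  set D₀ := (⋃ ν, D ν)ᶜ with hD₀
  set m : ℂ := ⨍ x in D₀, (a : M → ℂ) x ∂μ with hm
  have hD₀m : NullMeasurableSet D₀ μ := (nullMeasurableSet_iUnion_of_frontier hμ hD).compl
  have hnull : a - m • (1 : smoothFunctions d M) ∈ nullObservables I (meanSeminorm Op φ J) := by
    refine HSBounded.mem_nullObservables hOp (hsBounded_meanSeminorm (Op := Op) (φ := φ) J)
      (mem_nullClosure_of_forall_inner fun g hg => ?_)
    obtain ⟨R, hRo, hR0, hR⟩ := exists_isOpen_egorov hΦ hμ hΦμ hU 1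
    have hinv : koopman hΦμ g = g := by
      refine koopman_eq_self_of_forall_inner (d := d) hΦμ g hRo hR0 fun c hc => ?_
      obtain ⟨b, hb, hbE⟩ := hR c hc
      simp only [pow_one] at hbE
      rw [koopman_toL2 hΦμ hb, ← map_sub]
      exact hg _ (sub_mem_nullObservables_meanSeminorm J hφ hbE)
    have hinv' : (g : M → ℂ) ∘ Φ =ᵐ[μ] g := by
      have := Lp.coeFn_compMeasurePreserving g hΦμ
      have h2 : Lp.compMeasurePreserving Φ hΦμ g = g := hinv
      rw [h2] at this
      exact this.symm
    obtain ⟨c, hc⟩ := herg.ae_eq_const_of_ae_eq_comp_ae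
      (Lp.aestronglyMeasurable g).restrict (ae_restrict_of_ae hinv')
    -- Property (i) applies to every observable supported in the interior of some `D ν`; the
    -- frontiers are null.
    have hoff : ∀ᵐ x ∂μ, x ∈ D₀ᶜ → g x = 0 := by
      have h1 : ∀ ν, ∀ᵐ x ∂μ, x ∈ interior (D ν) → g x = 0 := fun ν => by
        refine ae_eq_zero_of_forall_inner_toL2 g isOpen_interior fun b hb => hg b ?_
        refine (mem_nullObservables_meanSeminorm J b).2 (hJ b fun x hx => ?_)
        exact image_eq_zero_of_notMem_tsupport fun h =>
          hx (Set.mem_iUnion.2 ⟨ν, interior_subset (hb h)⟩)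
      filter_upwards [ae_all_iff.2 h1, ae_mem_core_of_frontier_null hμ hD] with x hx hx' hxD
      rw [hD₀, compl_compl] at hxD
      obtain ⟨ν, hν⟩ := Set.mem_iUnion.1 hxD
      exact hx ν (hx' ν hν)
    have hint := integrable_mul_star (a - m • (1 : smoothFunctions d M)) g
    rw [inner_toL2, ← integral_add_compl₀ hD₀m hint]
    have e1 : ∫ x in D₀, ((a - m • (1 : smoothFunctions d M) : smoothFunctions d M) : M → ℂ) x *
          star (g x) ∂μ = 0 := by
      -- This also covers `μ(D₀) = 0`, when the average is `0` and the restricted measure vanishes.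
      have : ∫ x in D₀, ((a : M → ℂ) x - m) * star c ∂μ = 0 := by
        rw [integral_mul_const, hm, integral_sub_average, zero_mul]
      rw [← this]
      refine integral_congr_ae ?_
      filter_upwards [hc] with x hx
      rw [hx]
      simp
    have e2 : ∫ x in D₀ᶜ, ((a - m • (1 : smoothFunctions d M) : smoothFunctions d M) : M → ℂ) x *
          star (g x) ∂μ = 0 := by
      refine integral_eq_zero_of_ae ?_
      refine (ae_restrict_iff'₀ hD₀m.compl).2 ?_
      filter_upwards [hoff] with x hx hxD
      simp [hx hxD]
    rw [e1, e2, add_zero]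
  have hlim : Tendsto (fun N => ‖expectationVec (φ N) (J N) (Op N a - m • 1)‖) (limAlong I)
      (𝓝 0) := by
    have h0 := (mem_nullObservables.1 hnull).add ((tendsto_nhs_one_sub φ hOp).const_mul ‖m‖)
    rw [mul_zero, add_zero] at h0
    refine squeeze_zero (fun N => norm_nonneg _) (fun N => ?_) h0
    -- The constant `m` is quantised as `m • Op N 1`; it is replaced by the scalar matrix at
    -- Hilbert–Schmidt cost.
    have : Op N a - m • 1 = Op N (a - m • (1 : smoothFunctions d M)) + m • (Op N 1 - 1) := by
      rw [map_sub, map_smul, smul_sub]; abel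
    rw [this, map_add, map_smul]
    refine (norm_add_le _ _).trans (add_le_add le_rfl ?_)
    rw [norm_smul]
    gcongr
    exact norm_expectationVec_le _ _ _
  have h2 := hlim.pow 2
  simp_rw [norm_expectationVec_sq] at h2
  rw [zero_pow two_ne_zero] at h2
  refine h2.congr fun N => ?_
  congr 1
  refine Finset.sum_congr rfl fun j _ => ?_
  simp [expectation]

end ErgodicPart

/-! ### Equidistribution of eigenphases on the aperiodic part -/

section Spectral

variable {d : ℕ} {M : Type*} [TopologicalSpace M] [CompactSpace M] [T2Space M]
  [ChartedSpace (EuclideanSpace ℝ (Fin d)) M] [IsManifold (𝓡 d) ∞ M]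
  [MeasurableSpace M] [BorelSpace M]
  {μ : Measure M} [IsProbabilityMeasure μ] {Φ : Equiv.Perm M} {𝒰 : ℕ → Set M}
  {I : Set ℕ} {Op : (N : ℕ) → smoothFunctions d M →ₗ[ℂ] Matrix (Fin N) (Fin N) ℂ}
  {U : (N : ℕ) → Matrix.unitaryGroup (Fin N) ℂ}
  {φ : (N : ℕ) → OrthonormalBasis (Fin N) ℂ (EuclideanSpace ℂ (Fin N))}
  {θ : (N : ℕ) → Fin N → UnitAddCircle}

/-- `φ_j` is an eigenvector of `U_N` with eigenphase `θ_j`, for `N ∈ I`. -/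
def IsEigenbasis (I : Set ℕ) (U : (N : ℕ) → Matrix.unitaryGroup (Fin N) ℂ)
    (φ : (N : ℕ) → OrthonormalBasis (Fin N) ℂ (EuclideanSpace ℂ (Fin N)))
    (θ : (N : ℕ) → Fin N → UnitAddCircle) : Prop :=
  ∀ N ∈ I, ∀ j, Matrix.toEuclideanCLM (n := Fin N) (𝕜 := ℂ) (U N).1 (φ N j)
    = fourier 1 (θ N j) • φ N j

lemma toEuclideanCLM_pow_eigenvector {N : ℕ} {V : Matrix (Fin N) (Fin N) ℂ}
    {ψ : EuclideanSpace ℂ (Fin N)} {t : UnitAddCircle}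
    (h : Matrix.toEuclideanCLM (n := Fin N) (𝕜 := ℂ) V ψ = fourier 1 t • ψ) (n : ℕ) :
    Matrix.toEuclideanCLM (n := Fin N) (𝕜 := ℂ) (V ^ n) ψ = fourier n t • ψ := by
  induction n with
  | zero => simp
  | succ n ih =>
    rw [pow_succ, map_mul, mul_apply_eq_comp, h, map_smul, ih, smul_smul, Nat.cast_succ,
      fourier_add, mul_comm]

lemma toEuclideanCLM_inv_eigenvector {N : ℕ} {V : Matrix.unitaryGroup (Fin N) ℂ}
    {ψ : EuclideanSpace ℂ (Fin N)} {t : UnitAddCircle} {n : ℤ}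
    (h : Matrix.toEuclideanCLM (n := Fin N) (𝕜 := ℂ) V.1 ψ = fourier n t • ψ) :
    Matrix.toEuclideanCLM (n := Fin N) (𝕜 := ℂ) (V⁻¹ : Matrix.unitaryGroup (Fin N) ℂ).1 ψ
      = fourier (-n) t • ψ := by
  have h1 : (V⁻¹ : Matrix.unitaryGroup (Fin N) ℂ).1 * V.1 = 1 :=
    Matrix.mem_unitaryGroup_iff'.1 V.2
  have h2 : Matrix.toEuclideanCLM (n := Fin N) (𝕜 := ℂ)
      ((V⁻¹ : Matrix.unitaryGroup (Fin N) ℂ).1 * V.1) ψ = ψ := by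
    rw [h1, map_one, one_apply_eq_self]
  rw [map_mul, mul_apply_eq_comp, h, map_smul] at h2
  have h3 : fourier (-n) t * fourier n t = 1 := by
    rw [← fourier_add, neg_add_cancel, fourier_zero]
  have h4 := congrArg (fun v => fourier (-n) t • v) h2
  simpa only [smul_smul, h3, one_smul] using h4

lemma norm_fourier_apply (n : ℤ) (t : UnitAddCircle) : ‖fourier n t‖ = 1 := by
  rw [fourier_apply]
  exact Circle.norm_coe _

lemma weightedTrace_eq_trace_mul {N : ℕ}
    (φ : OrthonormalBasis (Fin N) ℂ (EuclideanSpace ℂ (Fin N))) {V : Matrix (Fin N) (Fin N) ℂ}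
    {z : Fin N → ℂ} (h : ∀ j, Matrix.toEuclideanCLM (n := Fin N) (𝕜 := ℂ) V (φ j) = z j • φ j)
    (A : Matrix (Fin N) (Fin N) ℂ) :
    weightedTrace φ z A = (1 / (N : ℂ)) * (A * V).trace := by
  rw [weightedTrace_apply, trace_eq_sum_expectation φ]
  congr 1
  refine Finset.sum_congr rfl fun j _ => ?_
  rw [expectation, expectation, map_mul, mul_apply_eq_comp, h, map_smul, inner_smul_right]

/-- Egorov's theorem is available for natural powers, so the power of `U` for negative `n` is
recorded as an inverse of one. -/
lemma IsEigenbasis.exists_unitary (hφ : IsEigenbasis I U φ θ) {N : ℕ} (hN : N ∈ I) (n : ℤ) :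
    ∃ V : Matrix.unitaryGroup (Fin N) ℂ, (V = U N ^ n.natAbs ∨ V = (U N ^ n.natAbs)⁻¹) ∧
      ∀ j, Matrix.toEuclideanCLM (n := Fin N) (𝕜 := ℂ) V.1 (φ N j)
        = fourier n (θ N j) • φ N j := by
  have h : ∀ j, Matrix.toEuclideanCLM (n := Fin N) (𝕜 := ℂ) (U N ^ n.natAbs).1 (φ N j)
        = fourier (n.natAbs : ℤ) (θ N j) • φ N j := fun j => by
    rw [← toEuclideanCLM_pow_eigenvector (hφ N hN j)]; rfl
  rcases Int.natAbs_eq n with hn | hn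
  · exact ⟨_, Or.inl rfl, fun j => by rw [h, ← hn]⟩
  · refine ⟨_, Or.inr rfl, fun j => ?_⟩
    rw [toEuclideanCLM_inv_eigenvector (h j), ← hn]

/-- If conjugation by `V` carries `C` to approximately `B`, then `Tr (ACV) ≈ Tr (BAV)`. -/
lemma norm_trace_conj_sub_le {N : ℕ} (φ : OrthonormalBasis (Fin N) ℂ (EuclideanSpace ℂ (Fin N)))
    (V : Matrix.unitaryGroup (Fin N) ℂ) (A B C : Matrix (Fin N) (Fin N) ℂ) :
    ‖(1 / (N : ℂ)) * ((A * C - B * A) * V.1).trace‖ ≤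
      opNorm ((V⁻¹ : Matrix.unitaryGroup (Fin N) ℂ).1 * C * V.1 - B) * nhs φ A := by
  have h1 : V.1 * (V⁻¹ : Matrix.unitaryGroup (Fin N) ℂ).1 = 1 := Matrix.mem_unitaryGroup_iff.1 V.2
  have h : ((A * C - B * A) * V.1).trace
      = (V.1 * ((V⁻¹ : Matrix.unitaryGroup (Fin N) ℂ).1 * C * V.1 - B) * A).trace := by
    rw [mul_sub, ← mul_assoc, ← mul_assoc, h1, one_mul, sub_mul, sub_mul, Matrix.trace_sub,
      Matrix.trace_sub, mul_assoc A C, Matrix.trace_mul_comm A, mul_assoc B A,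
      Matrix.trace_mul_comm B, mul_assoc A, Matrix.trace_mul_comm A, mul_assoc]
  rw [h]
  refine (norm_trace_mul_mul_le φ _ _ _).trans ?_
  gcongr
  · exact nhs_nonneg _ _
  · exact mul_le_of_le_one_left (opNorm_nonneg _) (opNorm_unitary_le V)

/-- If conjugation by `V` carries `C` to approximately `B`, then `Tr (BAV⁻¹) ≈ Tr (ACV⁻¹)`. -/
lemma norm_trace_conj_inv_sub_le {N : ℕ}
    (φ : OrthonormalBasis (Fin N) ℂ (EuclideanSpace ℂ (Fin N)))
    (V : Matrix.unitaryGroup (Fin N) ℂ) (A B C : Matrix (Fin N) (Fin N) ℂ) :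
    ‖(1 / (N : ℂ)) * ((C * A - A * B) * (V⁻¹ : Matrix.unitaryGroup (Fin N) ℂ).1).trace‖ ≤
      opNorm ((V⁻¹ : Matrix.unitaryGroup (Fin N) ℂ).1 * C * V.1 - B) * nhs φ A := by
  have h1 : V.1 * (V⁻¹ : Matrix.unitaryGroup (Fin N) ℂ).1 = 1 := Matrix.mem_unitaryGroup_iff.1 V.2
  have h : ((C * A - A * B) * (V⁻¹ : Matrix.unitaryGroup (Fin N) ℂ).1).trace
      = (((V⁻¹ : Matrix.unitaryGroup (Fin N) ℂ).1 * C * V.1 - B) *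
        (V⁻¹ : Matrix.unitaryGroup (Fin N) ℂ).1 * A).trace := by
    rw [sub_mul, sub_mul, sub_mul, mul_assoc _ V.1, h1, mul_one, Matrix.trace_sub,
      Matrix.trace_sub, Matrix.trace_mul_comm (C * A), ← mul_assoc, mul_assoc A B,
      Matrix.trace_mul_comm A]
  rw [h]
  refine (norm_trace_mul_mul_le φ _ _ _).trans ?_
  gcongr
  · exact nhs_nonneg _ _
  · exact mul_le_of_le_one_right (opNorm_nonneg _) (opNorm_unitary_le V⁻¹)

/-- `a ↦ |N⁻¹ ∑ h_j ⟨Op(a) φ_j, φ_j⟩|`. -/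
noncomputable def traceSeminorm
    (Op : (N : ℕ) → smoothFunctions d M →ₗ[ℂ] Matrix (Fin N) (Fin N) ℂ)
    (φ : (N : ℕ) → OrthonormalBasis (Fin N) ℂ (EuclideanSpace ℂ (Fin N)))
    (h : (N : ℕ) → Fin N → ℂ) (N : ℕ) : Seminorm ℂ (smoothFunctions d M) :=
  (normSeminorm ℂ _).comp (weightedTrace (φ N) (h N) ∘ₗ Op N)

lemma traceSeminorm_apply (h : (N : ℕ) → Fin N → ℂ) (N : ℕ) (a : smoothFunctions d M) :
    traceSeminorm Op φ h N a = ‖weightedTrace (φ N) (h N) (Op N a)‖ := rfl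

lemma hsBounded_traceSeminorm {h : (N : ℕ) → Fin N → ℂ} {C : ℝ} (hC : 0 ≤ C)
    (hh : ∀ N j, ‖h N j‖ ≤ C) : HSBounded Op φ (traceSeminorm Op φ h) C := fun N _ =>
  norm_weightedTrace_le (φ N) (h N) hC (hh N) _

lemma tendsto_opNorm_mul_sub_mul_comm (hOp : ObservableCorrespondence μ I Op)
    (a c : smoothFunctions d M) :
    Tendsto (fun N => opNorm (Op N (a * c) - Op N a * Op N c)) (limAlong I) (𝓝 0) := by
  refine (hOp.mul a c).congr fun N => ?_
  rw [opNorm, opNorm, ← norm_neg, ← map_neg, neg_sub]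

/-- Egorov's theorem makes `(c - c ∘ Φ^|n|) a` negligible for `Tr U^n Op(·)`. -/
lemma sub_mul_mem_nullObservables (hOp : ObservableCorrespondence μ I Op)
    (hφ : IsEigenbasis I U φ θ) (n : ℤ) {c b : smoothFunctions d M}
    (h : SemiclassicalEquiv I (fun N => ((U N ^ n.natAbs)⁻¹ : Matrix.unitaryGroup (Fin N) ℂ).1 *
      Op N c * (U N ^ n.natAbs).1) (fun N => Op N b)) (a : smoothFunctions d M) :
    (c - b) * a ∈ nullObservables I (traceSeminorm Op φ fun N j => fourier n (θ N j)) := by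
  have hw : ∀ N A, ‖weightedTrace (φ N) (fun j => fourier n (θ N j)) A‖ ≤ opNorm A := by
    intro N A
    refine (norm_weightedTrace_le (φ N) _ zero_le_one
      (fun j => (norm_fourier_apply _ _).le) A).trans ?_
    rw [one_mul]; exact nhs_le_opNorm _ _
  have hE := Tendsto.mul h (tendsto_nhs φ hOp a)
  -- A single majorant serves both signs of `n`; each case needs the Egorov term and two of the four
  -- commutation errors, and drops the others as nonnegative.
  have h0 := ((hE.add (tendsto_opNorm_mul_sub_mul_comm hOp a c)).add
    (tendsto_opNorm_mul_sub_mul_comm hOp b a)).add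
    ((tendsto_opNorm_mul_sub_mul_comm hOp c a).add (tendsto_opNorm_mul_sub_mul_comm hOp a b))
  simp only [zero_mul, add_zero] at h0
  refine mem_nullObservables.2 (squeeze_zero' (Eventually.of_forall fun N => apply_nonneg _ _) ?_ h0)
  filter_upwards [eventually_mem_limAlong I] with N hN
  obtain ⟨V, hV, hVe⟩ := hφ.exists_unitary hN n
  have hs := opNorm_nonneg (N := N)
  rw [traceSeminorm_apply]
  rcases hV with rfl | rfl
  · have e1 : Op N ((c - b) * a) = (Op N (a * c) - Op N a * Op N c)
        + (Op N a * Op N c - Op N b * Op N a) - (Op N (b * a) - Op N b * Op N a) := by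
      rw [sub_mul, map_sub, mul_comm c a]; abel
    rw [e1, map_sub, map_add]
    have h1 := norm_trace_conj_sub_le (φ N) (U N ^ n.natAbs) (Op N a) (Op N b) (Op N c)
    rw [← weightedTrace_eq_trace_mul (φ N) hVe] at h1
    refine (norm_sub_le _ _).trans ((add_le_add (norm_add_le _ _) le_rfl).trans ?_)
    linarith [hw N (Op N (a * c) - Op N a * Op N c), hw N (Op N (b * a) - Op N b * Op N a),
      hs (Op N (c * a) - Op N c * Op N a), hs (Op N (a * b) - Op N a * Op N b)]
  · have e1 : Op N ((c - b) * a) = (Op N (c * a) - Op N c * Op N a)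
        + (Op N c * Op N a - Op N a * Op N b) - (Op N (a * b) - Op N a * Op N b) := by
      rw [sub_mul, map_sub, mul_comm b a]; abel
    rw [e1, map_sub, map_add]
    have h1 := norm_trace_conj_inv_sub_le (φ N) (U N ^ n.natAbs) (Op N a) (Op N b) (Op N c)
    rw [← weightedTrace_eq_trace_mul (φ N) hVe] at h1
    refine (norm_sub_le _ _).trans ((add_le_add (norm_add_le _ _) le_rfl).trans ?_)
    linarith [hw N (Op N (c * a) - Op N c * Op N a), hw N (Op N (a * b) - Op N a * Op N b),
      hs (Op N (a * c) - Op N a * Op N c), hs (Op N (b * a) - Op N b * Op N a)]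

/-- A function which is orthogonal to all `(c - c ∘ Ψ) a` vanishes off the fixed points of `Ψ`. -/
lemma ae_eq_zero_of_forall_inner_sub_mul (g : Lp ℂ 2 μ) {Ψ : M → M} {R : Set M} (hR : IsOpen R)
    (hR0 : μ Rᶜ = 0)
    (H : ∀ c : smoothFunctions d M, tsupport (c : M → ℂ) ⊆ R → ∃ b : smoothFunctions d M,
      (b : M → ℂ) = (c : M → ℂ) ∘ Ψ ∧ ∀ a, inner ℂ g (toL2 μ ((c - b) * a)) = 0) :
    ∀ᵐ x ∂μ, Ψ x ≠ x → g x = 0 := by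
  have := secondCountableTopology_of_charted d M
  -- The factor `a` is arbitrary, so orthogonality to all `(c - c ∘ Ψ) a` forces the pointwise
  -- identity almost everywhere.
  have key : ∀ c : smoothFunctions d M, tsupport (c : M → ℂ) ⊆ R →
      ∀ᵐ x ∂μ, ((c : M → ℂ) x - (c : M → ℂ) (Ψ x)) * star (g x) = 0 := by
    intro c hc
    obtain ⟨b, hb, hab⟩ := H c hc
    filter_upwards [ae_eq_zero_of_forall_integral_mul (d := d) (integrable_mul_star (c - b) g)
      isOpen_univ fun a _ => by
        rw [← hab a, inner_toL2]
        refine integral_congr_ae (Eventually.of_forall fun x => ?_)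
        simp; ring] with x hx
    simpa [hb] using hx trivial
  have hbump : ∀ B : Set M, IsOpen B → ∃ c : smoothFunctions d M,
      Function.support (c : M → ℂ) = B := by
    intro B hB
    obtain ⟨f, hf, hfs, -⟩ := hB.exists_contMDiff_support_eq (𝓡 d) (n := ⊤)
    refine ⟨smoothOfReal f hfs, ?_⟩
    rw [← hf]; ext x; simp [smoothOfReal]
  -- If `Ψ x ≠ x`, some basic set `B` contains `x` but not `Ψ x`; a smooth `c` with support exactly
  -- `B` separates them. Countability of the basis leaves a single exceptional null set.
  have hae : ∀ᵐ x ∂μ, ∀ B ∈ TopologicalSpace.countableBasis M, closure B ⊆ R →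
      x ∈ B → Ψ x ∉ B → g x = 0 := by
    refine (ae_ball_iff (TopologicalSpace.countable_countableBasis M)).2 fun B hB => ?_
    by_cases hBR : closure B ⊆ R
    · obtain ⟨c, hc⟩ := hbump B (TopologicalSpace.isOpen_of_mem_countableBasis hB)
      filter_upwards [key c (by rw [tsupport, hc]; exact hBR)] with x hx _ hxB hΨ
      rw [← hc, Function.mem_support] at hxB
      rw [← hc, Function.notMem_support] at hΨ
      rw [hΨ, sub_zero] at hx
      simpa using (mul_eq_zero.1 hx).resolve_left hxB
    · exact Eventually.of_forall fun x h => absurd h hBR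
  filter_upwards [hae, measure_eq_zero_iff_ae_notMem.1 hR0] with x hx hxR hne
  have hn : R ∩ {Ψ x}ᶜ ∈ 𝓝 x :=
    inter_mem (hR.mem_nhds (by simpa using hxR)) (isOpen_compl_singleton.mem_nhds hne.symm)
  obtain ⟨B, hB, hxB, hBc⟩ :=
    (TopologicalSpace.isBasis_countableBasis M).exists_closure_subset hn
  exact hx B hB (hBc.trans Set.inter_subset_left) hxB fun h => (hBc (subset_closure h)).2 rfl

/-- Functions vanishing on the fixed points of `Φ^|n|` are negligible for `Tr U^n Op(·)`. -/
lemma mem_nullClosure_of_ae_fixed (hμ : AbsContLebesgue d μ)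
    (hΦμ : MeasurePreserving Φ μ μ) (hΦ : IsPiecewiseSmooth d Φ 𝒰)
    (hOp : ObservableCorrespondence μ I Op) (hU : MapCorrespondence Φ 𝒰 I Op U)
    (hφ : IsEigenbasis I U φ θ) (n : ℤ) {f : Lp ℂ 2 μ}
    (hf : ∀ᵐ x ∂μ, Φ^[n.natAbs] x = x → f x = 0) :
    f ∈ nullClosure μ I (traceSeminorm Op φ fun N j => fourier n (θ N j)) := by
  refine mem_nullClosure_of_forall_inner fun g hg => ?_
  obtain ⟨R, hRo, hR0, hR⟩ := exists_isOpen_egorov hΦ hμ hΦμ hU n.natAbs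
  have := ae_eq_zero_of_forall_inner_sub_mul (d := d) g hRo hR0 (Ψ := Φ^[n.natAbs]) fun c hc => by
    obtain ⟨b, hb, hbE⟩ := hR c hc
    exact ⟨b, hb, fun a => hg _ (sub_mul_mem_nullObservables hOp hφ n hbE a)⟩
  rw [L2.inner_def]
  refine integral_eq_zero_of_ae ?_
  filter_upwards [hf, this] with x h1 h2
  by_cases hx : Φ^[n.natAbs] x = x
  · simp [h1 hx]
  · simp [h2 hx]

end Spectral

/-! ### Counting eigenphases -/

section Counting

variable {d : ℕ} {M : Type*} [TopologicalSpace M] [CompactSpace M] [T2Space M]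
  [ChartedSpace (EuclideanSpace ℝ (Fin d)) M] [IsManifold (𝓡 d) ∞ M]
  [MeasurableSpace M] [BorelSpace M]
  {μ : Measure M} [IsProbabilityMeasure μ] {Φ : Equiv.Perm M} {𝒰 : ℕ → Set M}
  {I : Set ℕ} {Op : (N : ℕ) → smoothFunctions d M →ₗ[ℂ] Matrix (Fin N) (Fin N) ℂ}
  {U : (N : ℕ) → Matrix.unitaryGroup (Fin N) ℂ}
  {φ : (N : ℕ) → OrthonormalBasis (Fin N) ℂ (EuclideanSpace ℂ (Fin N))}
  {θ : (N : ℕ) → Fin N → UnitAddCircle}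

/-- The mean of a continuous function on the circle. -/
noncomputable def circleMean (h : C(UnitAddCircle, ℂ)) : ℂ := ∫ t, h t ∂AddCircle.haarAddCircle

lemma integrable_circle (h : C(UnitAddCircle, ℂ)) :
    Integrable (h : UnitAddCircle → ℂ) AddCircle.haarAddCircle :=
  h.continuous.integrable_of_hasCompactSupport (HasCompactSupport.of_compactSpace _)

lemma circleMean_add (h k : C(UnitAddCircle, ℂ)) :
    circleMean (h + k) = circleMean h + circleMean k :=
  integral_add (integrable_circle h) (integrable_circle k)

lemma circleMean_smul (c : ℂ) (h : C(UnitAddCircle, ℂ)) :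
    circleMean (c • h) = c * circleMean h := integral_const_mul _ _

lemma circleMean_fourier {n : ℤ} (hn : n ≠ 0) : circleMean (fourier n) = 0 := by
  have h := congrFun (fourierCoeff_fourier (T := 1) n) 0
  rw [Pi.single_eq_of_ne hn.symm] at h
  simpa [fourierCoeff, circleMean] using h

lemma norm_circleMean_le (h : C(UnitAddCircle, ℂ)) : ‖circleMean h‖ ≤ ‖h‖ := by
  refine (norm_integral_le_of_norm_le_const (C := ‖h‖)
    (Eventually.of_forall fun t => h.norm_coe_le_norm t)).trans ?_
  simp

lemma circleMean_sub (h k : C(UnitAddCircle, ℂ)) :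
    circleMean (h - k) = circleMean h - circleMean k :=
  integral_sub (integrable_circle h) (integrable_circle k)

/-- For observables close to `f` in `L²`, the eigenphases weighted by `⟨Op(c) φ_j, φ_j⟩` are
asymptotically equidistributed when tested against `h`. -/
def EquidistributedNear (μ : Measure M) [IsProbabilityMeasure μ] (I : Set ℕ)
    (Op : (N : ℕ) → smoothFunctions d M →ₗ[ℂ] Matrix (Fin N) (Fin N) ℂ)
    (φ : (N : ℕ) → OrthonormalBasis (Fin N) ℂ (EuclideanSpace ℂ (Fin N)))
    (θ : (N : ℕ) → Fin N → UnitAddCircle) (f : Lp ℂ 2 μ) (h : C(UnitAddCircle, ℂ)) : Prop :=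
  ∀ ε > 0, ∃ κ > 0, ∀ c : smoothFunctions d M, ‖toL2 μ c - f‖ < κ → ∀ᶠ N in limAlong I,
    ‖weightedTrace (φ N) (fun j => h (θ N j) - circleMean h) (Op N c)‖ < ε

lemma weightedTrace_add_weight {N : ℕ} (ψ : OrthonormalBasis (Fin N) ℂ (EuclideanSpace ℂ (Fin N)))
    (z w : Fin N → ℂ) (A : Matrix (Fin N) (Fin N) ℂ) :
    weightedTrace ψ (fun j => z j + w j) A = weightedTrace ψ z A + weightedTrace ψ w A := by
  simp only [weightedTrace_apply, add_mul, Finset.sum_add_distrib, mul_add]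

lemma weightedTrace_smul_weight {N : ℕ}
    (ψ : OrthonormalBasis (Fin N) ℂ (EuclideanSpace ℂ (Fin N)))
    (c : ℂ) (z : Fin N → ℂ) (A : Matrix (Fin N) (Fin N) ℂ) :
    weightedTrace ψ (fun j => c * z j) A = c * weightedTrace ψ z A := by
  simp only [weightedTrace_apply, Finset.mul_sum]
  exact Finset.sum_congr rfl fun j _ => by ring

lemma EquidistributedNear.add {f : Lp ℂ 2 μ} {h k : C(UnitAddCircle, ℂ)}
    (hh : EquidistributedNear μ I Op φ θ f h) (hk : EquidistributedNear μ I Op φ θ f k) :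
    EquidistributedNear μ I Op φ θ f (h + k) := by
  intro ε hε
  obtain ⟨κ₁, h₁, H₁⟩ := hh (ε / 2) (half_pos hε)
  obtain ⟨κ₂, h₂, H₂⟩ := hk (ε / 2) (half_pos hε)
  refine ⟨min κ₁ κ₂, lt_min h₁ h₂, fun c hc => ?_⟩
  filter_upwards [H₁ c (hc.trans_le (min_le_left _ _)), H₂ c (hc.trans_le (min_le_right _ _))]
    with N h1 h2
  have : (fun j => (h + k) (θ N j) - circleMean (h + k))
      = fun j => (h (θ N j) - circleMean h) + (k (θ N j) - circleMean k) := by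
    funext j; rw [circleMean_add, ContinuousMap.add_apply]; ring
  rw [this, weightedTrace_add_weight]
  linarith [norm_add_le (weightedTrace (φ N) (fun j => h (θ N j) - circleMean h) (Op N c))
    (weightedTrace (φ N) (fun j => k (θ N j) - circleMean k) (Op N c))]

lemma EquidistributedNear.smul {f : Lp ℂ 2 μ} {h : C(UnitAddCircle, ℂ)}
    (hh : EquidistributedNear μ I Op φ θ f h) (r : ℂ) :
    EquidistributedNear μ I Op φ θ f (r • h) := by
  intro ε hε
  obtain ⟨κ, hκ, H⟩ := hh (ε / (‖r‖ + 1)) (by positivity)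
  refine ⟨κ, hκ, fun c hc => ?_⟩
  filter_upwards [H c hc] with N h1
  have : (fun j => (r • h) (θ N j) - circleMean (r • h))
      = fun j => r * (h (θ N j) - circleMean h) := by
    funext j; rw [circleMean_smul, ContinuousMap.smul_apply, smul_eq_mul]; ring
  rw [this, weightedTrace_smul_weight, norm_mul]
  rw [lt_div_iff₀ (by positivity)] at h1
  nlinarith [norm_nonneg (weightedTrace (φ N) (fun j => h (θ N j) - circleMean h) (Op N c))]

/-- Changing `h` by `δ` uniformly changes the centred weights by at most `2δ`, and the
Hilbert–Schmidt norm is eventually below `‖f‖ + 2` for all `c` near `f`. -/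
lemma EquidistributedNear.of_forall_exists (hOp : ObservableCorrespondence μ I Op)
    {f : Lp ℂ 2 μ} {h : C(UnitAddCircle, ℂ)}
    (H : ∀ δ > 0, ∃ k, ‖h - k‖ < δ ∧ EquidistributedNear μ I Op φ θ f k) :
    EquidistributedNear μ I Op φ θ f h := by
  intro ε hε
  obtain ⟨k, hk, hkE⟩ := H (ε / (4 * (‖f‖ + 2))) (by positivity)
  obtain ⟨κ, hκ, Hκ⟩ := hkE (ε / 2) (half_pos hε)
  refine ⟨min κ 1, lt_min hκ one_pos, fun c hc => ?_⟩
  have hcn : ‖toL2 μ c‖ < ‖f‖ + 2 := by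
    have h1 := norm_le_norm_add_norm_sub' (toL2 μ c) f
    have h2 := hc.trans_le (min_le_right κ 1)
    linarith
  filter_upwards [Hκ c (hc.trans_le (min_le_left _ _)),
    (tendsto_nhs φ hOp c).eventually_lt_const hcn] with N h1 h2
  have e : (fun j => h (θ N j) - circleMean h) = fun j =>
      ((h - k) (θ N j) - circleMean (h - k)) + (k (θ N j) - circleMean k) := by
    funext j; rw [circleMean_sub, ContinuousMap.sub_apply]; ring
  have h3 : ‖weightedTrace (φ N) (fun j => (h - k) (θ N j) - circleMean (h - k)) (Op N c)‖
      ≤ (2 * ‖h - k‖) * nhs (φ N) (Op N c) := by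
    refine norm_weightedTrace_le _ _ (by positivity) (fun j => ?_) _
    refine (norm_sub_le _ _).trans ?_
    linarith [(h - k).norm_coe_le_norm (θ N j), norm_circleMean_le (h - k)]
  have h4 : (2 * ‖h - k‖) * nhs (φ N) (Op N c) ≤ (2 * (ε / (4 * (‖f‖ + 2)))) * (‖f‖ + 2) := by
    gcongr
    exact nhs_nonneg _ _
  have h5 : (2 * (ε / (4 * (‖f‖ + 2)))) * (‖f‖ + 2) = ε / 2 := by
    have : ‖f‖ + 2 ≠ 0 := by positivity
    field_simp
    ring
  rw [e, weightedTrace_add_weight]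
  refine (norm_add_le _ _).trans_lt ?_
  linarith

/-- Weyl's criterion: the zero mode is cancelled by subtracting the mean, the other Fourier modes
are traces against powers of `U`, and trigonometric polynomials are uniformly dense. -/
lemma equidistributedNear (hμ : AbsContLebesgue d μ)
    (hΦμ : MeasurePreserving Φ μ μ) (hΦ : IsPiecewiseSmooth d Φ 𝒰)
    (hOp : ObservableCorrespondence μ I Op) (hU : MapCorrespondence Φ 𝒰 I Op U)
    (hφ : IsEigenbasis I U φ θ) {f : Lp ℂ 2 μ}
    (hf : ∀ n : ℕ, 0 < n → ∀ᵐ x ∂μ, Φ^[n] x = x → f x = 0) (h : C(UnitAddCircle, ℂ)) :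
    EquidistributedNear μ I Op φ θ f h := by
  have hspan : ∀ k ∈ Submodule.span ℂ (Set.range (fourier : ℤ → C(UnitAddCircle, ℂ))),
      EquidistributedNear μ I Op φ θ f k := by
    intro k hk
    induction hk using Submodule.span_induction with
    | mem k hk =>
      obtain ⟨n, rfl⟩ := hk
      by_cases hn : n = 0
      · subst hn
        intro ε hε
        refine ⟨1, one_pos, fun c _ => Eventually.of_forall fun N => ?_⟩
        simpa [circleMean, weightedTrace_apply] using hε
      · intro ε hε
        simp only [circleMean_fourier hn, sub_zero]
        exact (hsBounded_traceSeminorm (Op := Op) (φ := φ) zero_le_one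
          (h := fun N j => fourier n (θ N j)) fun N j => (norm_fourier_apply _ _).le).eventually_lt
          hOp (mem_nullClosure_of_ae_fixed hμ hΦμ hΦ hOp hU hφ n
            (hf _ (Int.natAbs_pos.2 hn))) hε
    | zero =>
      intro ε hε
      refine ⟨1, one_pos, fun c _ => Eventually.of_forall fun N => ?_⟩
      simpa [circleMean, weightedTrace_apply] using hε
    | add x y _ _ hx hy => exact hx.add hy
    | smul a x _ hx => exact hx.smul a
  refine EquidistributedNear.of_forall_exists hOp fun δ hδ => ?_
  have hmem : h ∈ (Submodule.span ℂ
      (Set.range (fourier : ℤ → C(UnitAddCircle, ℂ)))).topologicalClosure := by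
    rw [span_fourier_closure_eq_top]; trivial
  obtain ⟨k, hk, hkd⟩ := Metric.mem_closure_iff.1 hmem δ hδ
  exact ⟨k, by rwa [← dist_eq_norm], hspan k hk⟩

lemma exists_toL2_sub_lt (f : Lp ℂ 2 μ) {κ : ℝ} (hκ : 0 < κ) :
    ∃ a : smoothFunctions d M, ‖toL2 μ a - f‖ < κ := by
  have hmem : f ∈ (LinearMap.range (toL2 (d := d) μ)).topologicalClosure := by
    refine mem_topologicalClosure_of_forall_inner fun g hg => ?_
    have h0 : g = 0 := by
      rw [Lp.eq_zero_iff_ae_eq_zero]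
      filter_upwards [ae_eq_zero_of_forall_inner_toL2 (d := d) g isOpen_univ
        fun b _ => hg _ ⟨b, rfl⟩] with x hx using hx trivial
    rw [h0, inner_zero_left]
  obtain ⟨_, ⟨a, rfl⟩, ha⟩ := Metric.mem_closure_iff.1 hmem κ hκ
  exact ⟨a, by rwa [dist_comm, dist_eq_norm] at ha⟩

/-- Upper bound in Weyl's law: the mean of `h(θ_j)` is at most the measure of the complement of
an aperiodic set `E`, up to a multiple of the mean of `h`. -/
lemma eventually_mean_le (hμ : AbsContLebesgue d μ)
    (hΦμ : MeasurePreserving Φ μ μ) (hΦ : IsPiecewiseSmooth d Φ 𝒰)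
    (hOp : ObservableCorrespondence μ I Op) (hU : MapCorrespondence Φ 𝒰 I Op U)
    (hφ : IsEigenbasis I U φ θ) {E : Set M} (hE : MeasurableSet E)
    (hEf : ∀ n : ℕ, 0 < n → ∀ᵐ x ∂μ, x ∈ E → Φ^[n] x ≠ x)
    (h : C(UnitAddCircle, ℝ)) (h01 : ∀ t, h t ∈ Set.Icc (0 : ℝ) 1) {ε : ℝ} (hε : 0 < ε) :
    ∀ᶠ N : ℕ in limAlong I, (1 / (N : ℝ)) * ∑ j, h (θ N j)
      ≤ μ.real Eᶜ + 8 * ∫ t, h t ∂AddCircle.haarAddCircle + ε := by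
  set u : Lp ℂ 2 μ := indicatorConstLp 2 hE.compl (measure_ne_top μ _) (1 : ℂ) with hu
  -- This is the class of the indicator of `E`. A smooth `a` close to it leaves `1 - a` with norm
  -- close to `‖u‖`, where `‖u‖² = μ(Eᶜ)`.
  set f : Lp ℂ 2 μ := toL2 μ (1 : smoothFunctions d M) - u with hf
  set H : C(UnitAddCircle, ℂ) := ⟨fun t => (h t : ℂ), by fun_prop⟩ with hH
  set s : ℝ := ∫ t, h t ∂AddCircle.haarAddCircle with hs
  have hHs : circleMean H = (s : ℂ) := integral_ofReal
  have hs0 : 0 ≤ s := integral_nonneg fun t => (h01 t).1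
  have hus : ‖u‖ ^ 2 = μ.real Eᶜ := by
    rw [hu, norm_indicatorConstLp (by simp) (by simp)]
    simp only [norm_one, one_mul, ENNReal.toReal_ofNat]
    rw [← Real.sqrt_eq_rpow, Real.sq_sqrt measureReal_nonneg]
  have hu1 : ‖u‖ ≤ 1 := by
    rw [← sq_le_one_iff₀ (norm_nonneg _), hus]
    exact measureReal_le_one
  have h1n : ‖toL2 μ (1 : smoothFunctions d M)‖ = 1 := norm_toL2_one μ
  have hfx : ∀ᵐ x ∂μ, x ∈ Eᶜ → f x = 0 := by
    filter_upwards [Lp.coeFn_sub (toL2 μ (1 : smoothFunctions d M)) u, coeFn_toL2 μ (1 : smoothFunctions d M),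
      indicatorConstLp_coeFn (p := 2) (hs := hE.compl) (hμs := measure_ne_top μ _) (c := (1 : ℂ))]
      with x h1 h2 h3 hx
    rw [hf, h1, Pi.sub_apply, h2, hu, h3, Set.indicator_of_mem hx]
    simp
  have hfix : ∀ n : ℕ, 0 < n → ∀ᵐ x ∂μ, Φ^[n] x = x → f x = 0 := fun n hn => by
    filter_upwards [hfx, hEf n hn] with x h1 h2 h3
    exact h1 fun hxE => h2 hxE h3
  set η : ℝ := min 1 (ε / 12) with hη
  have hη0 : 0 < η := lt_min one_pos (by positivity)
  have hη1 : η ≤ 1 := min_le_left _ _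
  have hηε : 12 * η ≤ ε := by linarith [min_le_right 1 (ε / 12)]
  obtain ⟨κ, hκ, Hκ⟩ := equidistributedNear hμ hΦμ hΦ hOp hU hφ hfix H η hη0
  obtain ⟨a, ha⟩ := exists_toL2_sub_lt (d := d) f (lt_min hκ hη0)
  have haη : ‖toL2 μ a - f‖ < η := ha.trans_le (min_le_right _ _)
  have hna : ‖toL2 μ a‖ < 4 := by
    have e1 := norm_le_norm_add_norm_sub' (toL2 μ a) f
    have e2 : ‖f‖ ≤ 2 := (norm_sub_le _ _).trans (by linarith)
    linarith
  have hnb : ‖toL2 μ (1 - a)‖ < ‖u‖ + η := by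
    have e : toL2 μ (1 - a) = u - (toL2 μ a - f) := by rw [map_sub, hf]; abel
    rw [e]
    exact (norm_sub_le _ _).trans_lt (by linarith)
  filter_upwards [Hκ a (ha.trans_le (min_le_left _ _)),
    (tendsto_nhs φ hOp a).eventually_lt_const hna,
    (tendsto_nhs φ hOp (1 - a)).eventually_lt_const hnb,
    (tendsto_nhs_one_sub φ hOp).eventually_lt_const hη0] with N b1 b2 b3 b4
  set X : ℝ := (1 / (N : ℝ)) * ∑ j, h (θ N j) with hX
  have hX0 : 0 ≤ X := mul_nonneg (by positivity) (Finset.sum_nonneg fun j _ => (h01 _).1)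
  have hHn : ∀ j, ‖H (θ N j)‖ = h (θ N j) := fun j => by
    rw [hH, ContinuousMap.coe_mk, Complex.norm_real, Real.norm_of_nonneg (h01 _).1]
  -- The identity is split as `-(Op 1 - 1) + Op a + Op (1 - a)`: a negligible part, an
  -- equidistributed part contributing a multiple of the mean of `h`, and the part off `E`.
  have hdec : (X : ℂ) = -weightedTrace (φ N) (fun j => H (θ N j)) (Op N 1 - 1)
      + (weightedTrace (φ N) (fun j => H (θ N j) - circleMean H) (Op N a)
        + s * weightedTrace (φ N) (fun _ => 1) (Op N a))
      + weightedTrace (φ N) (fun j => H (θ N j)) (Op N (1 - a)) := by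
    have e1 : weightedTrace (φ N) (fun j => H (θ N j)) 1 = X := by
      rw [weightedTrace_apply, hX]
      simp [expectation, hH]
    have e2 : weightedTrace (φ N) (fun j => H (θ N j) - circleMean H) (Op N a)
        + s * weightedTrace (φ N) (fun _ => 1) (Op N a)
        = weightedTrace (φ N) (fun j => H (θ N j)) (Op N a) := by
      rw [← weightedTrace_smul_weight, ← weightedTrace_add_weight, hHs]
      simp
    rw [e2, map_sub, map_sub, map_sub, e1]
    ring
  have c1 : ‖weightedTrace (φ N) (fun j => H (θ N j)) (Op N 1 - 1)‖ ≤ η := by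
    refine (norm_weightedTrace_le _ _ zero_le_one (fun j => ?_) _).trans (by linarith)
    rw [hHn]; exact (h01 _).2
  have c2 : ‖(s : ℂ) * weightedTrace (φ N) (fun _ => 1) (Op N a)‖ ≤ s * 4 := by
    rw [norm_mul, Complex.norm_real, Real.norm_of_nonneg hs0]
    gcongr
    refine (norm_weightedTrace_le _ _ zero_le_one (by simp) _).trans (by linarith)
  -- Since `h² ≤ h`, Cauchy–Schwarz gives `√X (‖u‖ + η)`. After the arithmetic-geometric inequality,
  -- `X/2` is absorbed on the left; doubling restores coefficient one for `μ(Eᶜ)` and turns `4s`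
  -- into `8s`.
  have c3 : ‖weightedTrace (φ N) (fun j => H (θ N j)) (Op N (1 - a))‖
      ≤ X / 2 + (‖u‖ + η) ^ 2 / 2 := by
    refine (norm_weightedTrace_le_sqrt _ _ _).trans ?_
    have d1 : √((1 / (N : ℝ)) * ∑ j, ‖H (θ N j)‖ ^ 2) ≤ √X := by
      refine Real.sqrt_le_sqrt ?_
      rw [hX]
      gcongr with j
      rw [hHn, sq]
      exact mul_le_of_le_one_left (h01 _).1 (h01 _).2
    calc _ ≤ √X * (‖u‖ + η) := by gcongr; exact nhs_nonneg _ _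
      _ ≤ _ := by
        have := Real.sq_sqrt hX0
        nlinarith [sq_nonneg (√X - (‖u‖ + η))]
  have hXn : X ≤ η + (η + s * 4) + (X / 2 + (‖u‖ + η) ^ 2 / 2) := by
    calc X = ‖(X : ℂ)‖ := by rw [Complex.norm_real, Real.norm_of_nonneg hX0]
      _ ≤ _ := by
        rw [hdec]
        refine (norm_add_le _ _).trans (add_le_add ((norm_add_le _ _).trans (add_le_add ?_ ?_)) c3)
        · rwa [norm_neg]
        · exact (norm_add_le _ _).trans (add_le_add b1.le c2)
  nlinarith [norm_nonneg u]

end Counting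

/-! ### Spectral windows -/

lemma haarAddCircle_eq_zero_of_finite {S : Set UnitAddCircle} (hS : S.Finite) :
    AddCircle.haarAddCircle S = 0 := by
  have h : (volume : Measure UnitAddCircle) S = 0 := by
    rw [← Set.biUnion_of_singleton S, measure_biUnion_null_iff hS.countable]
    intro t _
    have := AddCircle.volume_closedBall (T := 1) (x := t) 0
    simpa using this
  rw [AddCircle.volume_eq_smul_haarAddCircle] at h
  simpa using h

/-- Any two solutions differ by an `n`-torsion point of the circle. -/
lemma finite_setOf_fourier_eq {n : ℕ} (hn : 0 < n) (w : ℂ) :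
    {t : UnitAddCircle | fourier n t = w}.Finite := by
  rcases Set.eq_empty_or_nonempty {t : UnitAddCircle | fourier n t = w} with h | ⟨t₀, ht₀⟩
  · rw [h]; exact Set.finite_empty
  · refine ((AddCircle.finite_torsion (1 : ℝ) hn).image (· + t₀)).subset fun t ht => ?_
    refine ⟨t - t₀, ?_, sub_add_cancel t t₀⟩
    have h1 : fourier n t = fourier n t₀ := Eq.trans ht (Eq.symm ht₀)
    rw [fourier_apply, fourier_apply] at h1
    have h2 := AddCircle.injective_toCircle one_ne_zero (Circle.ext h1)
    simpa [smul_sub, sub_eq_zero] using h2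

/-- A finite set of phases has a neighbourhood `V` and a cutoff `h`, equal to `1` on `V`, of small
mean. -/
lemma exists_cutoff {S : Set UnitAddCircle} (hS : S.Finite) {η : ℝ} (hη : 0 < η) :
    ∃ V : Set UnitAddCircle, IsOpen V ∧ S ⊆ V ∧ ∃ h : C(UnitAddCircle, ℝ),
      (∀ t, h t ∈ Set.Icc (0 : ℝ) 1) ∧ (∀ t ∈ V, h t = 1) ∧
      ∫ t, h t ∂AddCircle.haarAddCircle ≤ η := by
  obtain ⟨W, hSW, hWo, hW⟩ := S.exists_isOpen_lt_of_lt (ENNReal.ofReal η)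
    (by rw [haarAddCircle_eq_zero_of_finite hS]; exact ENNReal.ofReal_pos.2 hη)
  obtain ⟨V, hVo, hSV, hVW⟩ := normal_exists_closure_subset hS.isClosed hWo hSW
  obtain ⟨h, h0, h1, h01⟩ := exists_continuous_zero_one_of_isClosed hWo.isClosed_compl
    (isClosed_closure (s := V)) (Set.disjoint_compl_left_iff_subset.2 hVW)
  refine ⟨V, hVo, hSV, h, h01, fun t ht => h1 (subset_closure ht), ?_⟩
  have hle : ∀ t, h t ≤ W.indicator 1 t := by
    intro t
    by_cases ht : t ∈ W
    · rw [Set.indicator_of_mem ht]; exact (h01 t).2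
    · rw [Set.indicator_of_notMem ht, h0 ht]; rfl
  calc ∫ t, h t ∂AddCircle.haarAddCircle
      ≤ ∫ t, W.indicator 1 t ∂AddCircle.haarAddCircle := by
        refine integral_mono ?_ ?_ hle
        · exact h.continuous.integrable_of_hasCompactSupport (HasCompactSupport.of_compactSpace _)
        · exact (integrable_const (1 : ℝ)).indicator hWo.measurableSet
    _ = (AddCircle.haarAddCircle W).toReal := by
        rw [integral_indicator_one hWo.measurableSet]; rfl
    _ ≤ η := ENNReal.toReal_le_of_le_ofReal hη.le hW.le

/-! ### A diagonal argument -/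

/-- At each `N`, take a witness for the largest attainable level `m ≤ N`; by monotonicity it serves
every lower level too. -/
lemma exists_diagonal {α : ℕ → Type*} [∀ N, Nonempty (α N)] {F : Filter ℕ} (hF : F ≤ atTop)
    (B : ℕ → (N : ℕ) → α N → Prop) (hB : ∀ m k N J, m ≤ k → B k N J → B m N J)
    (h : ∀ m, ∀ᶠ N in F, ∃ J, B m N J) : ∃ J : (N : ℕ) → α N, ∀ m, ∀ᶠ N in F, B m N (J N) := by
  classical
  have key : ∀ N, ∃ J : α N, ∀ m ≤ N, (∃ K, B m N K) → B m N J := by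
    intro N
    by_cases hN : ∃ m ≤ N, ∃ K, B m N K
    · obtain ⟨m₀, hm₀, hK⟩ := hN
      obtain ⟨J, hJ⟩ := Nat.findGreatest_spec (P := fun m => ∃ K, B m N K) hm₀ hK
      exact ⟨J, fun m hm hmK => hB _ _ _ _ (Nat.le_findGreatest hm hmK) hJ⟩
    · push Not at hN
      exact ⟨Classical.arbitrary _, fun m hm ⟨K, hK⟩ => absurd hK (hN m hm K)⟩
  choose J hJ using key
  refine ⟨J, fun m => ?_⟩
  filter_upwards [h m, hF (eventually_ge_atTop m)] with N h1 h2 using hJ N m h2 h1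

/-! ### Eigenstates localised on the aperiodic part -/

section Existence

variable {d : ℕ} {M : Type*} [TopologicalSpace M] [CompactSpace M] [T2Space M]
  [ChartedSpace (EuclideanSpace ℝ (Fin d)) M] [IsManifold (𝓡 d) ∞ M]
  [MeasurableSpace M] [BorelSpace M]
  {μ : Measure M} [IsProbabilityMeasure μ] {Φ : Equiv.Perm M} {𝒰 : ℕ → Set M}
  {I : Set ℕ} {Op : (N : ℕ) → smoothFunctions d M →ₗ[ℂ] Matrix (Fin N) (Fin N) ℂ}
  {U : (N : ℕ) → Matrix.unitaryGroup (Fin N) ℂ}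
  {φ : (N : ℕ) → OrthonormalBasis (Fin N) ℂ (EuclideanSpace ℂ (Fin N))}
  {θ : (N : ℕ) → Fin N → UnitAddCircle}
  {D : ℕ → Set M} {n : ℕ → ℕ} {α : ℕ → ℝ}

/-! ### Localisation away from the spectrum of the periodic domains -/

/-- The factor `e^{2πi n α}` by which `U^n` acts on a periodic domain. -/
noncomputable def periodPhase (n : ℕ) (α : ℝ) : ℂ :=
  Complex.exp (2 * Real.pi * Complex.I * (n * α))

/-- `U^k` on the left of `A` moves to the eigenvector in the other slot and becomes its eigenvalue,
so the bound is uniform in `j`. -/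
lemma norm_fourier_sub_mul_expectation_le (hφ : IsEigenbasis I U φ θ) {N : ℕ} (hN : N ∈ I)
    (k : ℕ) (w : ℂ) (A : Matrix (Fin N) (Fin N) ℂ) (j : Fin N) :
    ‖fourier k (θ N j) - w‖ * ‖expectation A (φ N j)‖ ≤ opNorm ((U N).1 ^ k * A - w • A) := by
  have h1 : Matrix.toEuclideanCLM (n := Fin N) (𝕜 := ℂ) ((U N).1 ^ k)ᴴ (φ N j)
      = fourier (-(k : ℤ)) (θ N j) • φ N j :=
    toEuclideanCLM_inv_eigenvector (V := U N ^ k) (toEuclideanCLM_pow_eigenvector (hφ N hN j) k)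
  have h2 : expectation ((U N).1 ^ k * A - w • A) (φ N j)
      = (fourier k (θ N j) - w) * expectation A (φ N j) := by
    rw [toEuclideanCLM_conjTranspose] at h1
    rw [expectation, map_sub, sub_apply, inner_sub_right, map_mul, mul_apply_eq_comp,
      ← ContinuousLinearMap.adjoint_inner_left, h1, inner_smul_left, fourier_neg, map_smul,
      smul_apply, inner_smul_right, expectation, sub_mul]
    simp
  rw [← norm_mul, ← h2]
  exact norm_expectation_le_opNorm _ _ _

lemma eventually_expectation_le (hφ : IsEigenbasis I U φ θ)
    (hD : PeriodicDomains Φ 𝒰 I Op U D n α) {ν : ℕ} {V : Set UnitAddCircle} (hV : IsOpen V)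
    (hνV : {t : UnitAddCircle | fourier (n ν) t = periodPhase (n ν) (α ν)} ⊆ V)
    {a : smoothFunctions d M} (ha : tsupport (a : M → ℂ) ⊆ smoothCore Φ 𝒰 (D ν) (n ν))
    {ε : ℝ} (hε : 0 < ε) :
    ∀ᶠ N in limAlong I, ∀ j, θ N j ∉ V → ‖expectation (Op N a) (φ N j)‖ ≤ ε := by
  -- The complement of `V` is compact and contains no solution, so the distance has a positive
  -- minimum there; if it is empty any `δ` will do.
  obtain ⟨δ, hδ, hδV⟩ : ∃ δ > 0, ∀ t ∈ Vᶜ, δ ≤ ‖fourier (n ν) t - periodPhase (n ν) (α ν)‖ := by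
    rcases Set.eq_empty_or_nonempty Vᶜ with h | h
    · exact ⟨1, one_pos, by simp [h]⟩
    · obtain ⟨t₀, ht₀, hmin⟩ := hV.isClosed_compl.isCompact.exists_isMinOn h
        (f := fun t => ‖fourier (n ν) t - periodPhase (n ν) (α ν)‖)
        (((fourier (n ν)).continuous.sub continuous_const).norm.continuousOn)
      exact ⟨_, norm_pos_iff.2 fun h0 => ht₀ (hνV (sub_eq_zero.1 h0)), fun t ht => hmin ht⟩
  have hph : SemiclassicalEquiv I (fun N => (U N).1 ^ n ν * Op N a)
      (fun N => periodPhase (n ν) (α ν) • Op N a) :=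
    hD.phase ν a (fun x hx => interior_subset (ha hx).1) fun k _ hk x hx i hi =>
      (ha hx).2 i (hi.trans_le hk)
  filter_upwards [eventually_mem_limAlong I,
    Tendsto.eventually_lt_const (mul_pos hδ hε) hph] with N hN hN' j hj
  have h1 := (norm_fourier_sub_mul_expectation_le hφ hN (n ν) (periodPhase (n ν) (α ν)) (Op N a)
    j).trans_lt hN'
  have h2 := hδV _ hj
  by_contra! hc
  nlinarith [norm_nonneg (expectation (Op N a) (φ N j))]

/-- A countable family of observables supported in the periodic domains which is dense, in `L²`,
among all such observables. -/
lemma exists_dense_localised_seq (μ : Measure M) [IsProbabilityMeasure μ]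
    (O : ℕ → Set M) : ∃ a : ℕ → smoothFunctions d M,
      (∀ i, ∃ ν, tsupport (a i : M → ℂ) ⊆ O ν) ∧
      ∀ b : smoothFunctions d M, (∃ ν, tsupport (b : M → ℂ) ⊆ O ν) →
        toL2 μ b ∈ closure (Set.range fun i => toL2 μ (a i)) := by
  have := secondCountableTopology_of_charted d M
  set S : Set (Lp ℂ 2 μ) := toL2 μ '' {b : smoothFunctions d M | ∃ ν, tsupport (b : M → ℂ) ⊆ O ν}
  have h0 : (0 : Lp ℂ 2 μ) ∈ S := ⟨0, ⟨0, by simp [tsupport]⟩, map_zero _⟩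
  have : Nonempty S := ⟨⟨0, h0⟩⟩
  have : SecondCountableTopology (Lp ℂ 2 μ) :=
    haveI : Fact ((2 : ENNReal) ≠ ⊤) := ⟨by simp⟩
    inferInstance
  choose a ha hau using fun i => (TopologicalSpace.denseSeq S i).2
  refine ⟨a, ha, fun b hb => ?_⟩
  have h1 := TopologicalSpace.denseRange_denseSeq S ⟨toL2 μ b, ⟨b, hb, rfl⟩⟩
  have h2 := image_closure_subset_closure_image continuous_subtype_val ⟨_, h1, rfl⟩
  rw [← Set.range_comp] at h2
  convert h2 using 3
  funext i
  exact hau i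

lemma aperiodic_of_periodicDomains (hμ : AbsContLebesgue d μ)
    (hD : PeriodicDomains Φ 𝒰 I Op U D n α) (k : ℕ) (hk : 0 < k) :
    ∀ᵐ x ∂μ, x ∈ (⋃ ν, D ν)ᶜ → Φ^[k] x ≠ x := by
  have h := measure_mono_null subset_closure
    ((hD.fixed_compl k (by exact_mod_cast hk.ne')).measure_closure_eq_zero hμ)
  filter_upwards [measure_eq_zero_iff_ae_notMem.1 h] with x hx hxD hfix
  refine hx ⟨hxD, ?_⟩
  rw [zpow_natCast, Equiv.Perm.coe_pow]
  exact hfix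

/-- For `N` large there are almost `μ(D₀) N` eigenstates carrying little of finitely many
observables supported in the periodic domains. -/
lemma eventually_exists_localised (hμ : AbsContLebesgue d μ)
    (hΦμ : MeasurePreserving Φ μ μ) (hΦ : IsPiecewiseSmooth d Φ 𝒰)
    (hOp : ObservableCorrespondence μ I Op) (hU : MapCorrespondence Φ 𝒰 I Op U)
    (hφ : IsEigenbasis I U φ θ) (hD : PeriodicDomains Φ 𝒰 I Op U D n α)
    {a : ℕ → smoothFunctions d M}
    (ha : ∀ i, ∃ ν, tsupport (a i : M → ℂ) ⊆ smoothCore Φ 𝒰 (D ν) (n ν)) (m : ℕ) {ε : ℝ}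
    (hε : 0 < ε) : ∀ᶠ N : ℕ in limAlong I, ∃ J : Finset (Fin N),
      (J.card : ℝ) ≤ μ.real (⋃ ν, D ν)ᶜ * N ∧ (μ.real (⋃ ν, D ν)ᶜ - ε) * N ≤ J.card ∧
      ∀ i ≤ m, (1 / (N : ℝ)) * ∑ j ∈ J, ‖expectation (Op N (a i)) (φ N j)‖ ^ 2 ≤ ε := by
  classical
  choose ν hν using ha
  set D₀ := (⋃ ν, D ν)ᶜ with hD₀
  have hD₀m : NullMeasurableSet D₀ μ := (nullMeasurableSet_iUnion_of_frontier hμ hD.boundary).compl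
  -- `D₀` is only null-measurable, so it is replaced by a measurable set equal to it almost
  -- everywhere.
  obtain ⟨E, hED, hEm, hEae⟩ := hD₀m.exists_measurable_superset_ae_eq
  have hEf : ∀ k : ℕ, 0 < k → ∀ᵐ x ∂μ, x ∈ E → Φ^[k] x ≠ x := fun k hk => by
    filter_upwards [aperiodic_of_periodicDomains hμ hD k hk, hEae.mem_iff] with x h1 h2 h3
    exact h1 (h2.1 h3)
  set r := μ.real D₀ with hr
  have hEr : μ.real Eᶜ = 1 - r := by
    rw [probReal_compl_eq_one_sub hEm, hr, measureReal_congr hEae]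
  set S : Set UnitAddCircle := ⋃ i ∈ Finset.range (m + 1),
    {t | fourier (n (ν i)) t = periodPhase (n (ν i)) (α (ν i))} with hS
  have hSf : S.Finite := Set.Finite.biUnion (Finset.finite_toSet _) fun i _ =>
    finite_setOf_fourier_eq (hD.one_le _) _
  -- The mean `ε/32` enters the Weyl bound with factor `8`; with the extra `ε/2` the total stays
  -- below `ε`.
  obtain ⟨V, hVo, hSV, h, h01, hV1, hint⟩ := exists_cutoff hSf (η := ε / 32) (by positivity)
  have hloc : ∀ᶠ N : ℕ in limAlong I, ∀ i ∈ Finset.range (m + 1), ∀ j, θ N j ∉ V →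
      ‖expectation (Op N (a i)) (φ N j)‖ ≤ √ε := by
    refine (Filter.eventually_all_finset _).2 fun i hi => ?_
    refine eventually_expectation_le hφ hD hVo (fun t ht => hSV ?_) (hν i) (Real.sqrt_pos.2 hε)
    exact Set.mem_biUnion hi ht
  have hlarge : ∀ᶠ N : ℕ in limAlong I, 1 ≤ ε * (N : ℝ) := by
    refine limAlong_le_atTop I ?_
    filter_upwards [eventually_ge_atTop ⌈1 / ε⌉₊] with N hN
    have : 1 / ε ≤ N := (Nat.le_ceil _).trans (by exact_mod_cast hN)
    rwa [div_le_iff₀' hε] at this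
  filter_upwards [hloc, hlarge, eventually_pos_limAlong I,
    eventually_mean_le hμ hΦμ hΦ hOp hU hφ hEm hEf h h01 (half_pos hε)] with N h1 h2 hN h3
  have hN' : (0 : ℝ) < N := by exact_mod_cast hN
  set G : Finset (Fin N) := Finset.univ.filter fun j => θ N j ∈ V with hG
  have hGc : (G.card : ℝ) ≤ ∑ j, h (θ N j) := by
    calc (G.card : ℝ) = ∑ j ∈ G, h (θ N j) := by
          rw [Finset.sum_congr rfl fun j hj => hV1 _ (Finset.mem_filter.1 hj).2,
            Finset.sum_const, nsmul_eq_mul, mul_one]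
      _ ≤ _ := Finset.sum_le_univ_sum_of_nonneg fun j => (h01 _).1
  have hGu : (G.card : ℝ) ≤ (1 - r + ε) * N := by
    rw [hEr, one_div, inv_mul_le_iff₀ hN'] at h3
    refine (hGc.trans h3).trans ?_
    rw [mul_comm]
    exact mul_le_mul_of_nonneg_right (by linarith) hN'.le
  have hcard : (Gᶜ.card : ℝ) = N - G.card := by
    rw [Finset.card_compl, Fintype.card_fin, Nat.cast_sub]
    simpa using G.card_le_univ
  -- The good indices may exceed `r N` in number, so they are cut down to `⌊r N⌋`; the loss from
  -- rounding is at most `1 ≤ ε N`.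
  obtain ⟨J, hJG, hJc⟩ := Finset.exists_subset_card_eq (s := Gᶜ)
    (n := min Gᶜ.card ⌊r * N⌋₊) (min_le_left _ _)
  have hr0 : 0 ≤ r := measureReal_nonneg
  refine ⟨J, ?_, ?_, fun i hi => ?_⟩
  · rw [hJc]
    exact (Nat.cast_le.2 (min_le_right _ _)).trans (Nat.floor_le (by positivity))
  · rw [hJc, Nat.cast_min, le_min_iff, hcard]
    refine ⟨by linarith, ?_⟩
    linarith [Nat.lt_floor_add_one (r * N)]
  · have h4 : ∑ j ∈ J, ‖expectation (Op N (a i)) (φ N j)‖ ^ 2 ≤ ∑ _j ∈ J, ε := by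
      refine Finset.sum_le_sum fun j hj => ?_
      have hjV : θ N j ∉ V := by
        have := hJG hj
        simpa [hG] using this
      have h5 := h1 i (Finset.mem_range.2 (Nat.lt_succ_of_le hi)) j hjV
      calc _ ≤ √ε ^ 2 := by gcongr
        _ = ε := Real.sq_sqrt hε.le
    have h6 : (J.card : ℝ) ≤ N := by exact_mod_cast (by simpa using J.card_le_univ)
    rw [Finset.sum_const, nsmul_eq_mul] at h4
    rw [one_div, inv_mul_le_iff₀ hN']
    exact h4.trans (by gcongr)

/-- Existence of localised eigenstates of full density. -/
theorem exists_localisedOn (hμ : AbsContLebesgue d μ)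
    (hΦμ : MeasurePreserving Φ μ μ) (hΦ : IsPiecewiseSmooth d Φ 𝒰)
    (hOp : ObservableCorrespondence μ I Op) (hU : MapCorrespondence Φ 𝒰 I Op U)
    (hφ : IsEigenbasis I U φ θ) (hD : PeriodicDomains Φ 𝒰 I Op U D n α) :
    ∃ J : (N : ℕ) → Finset (Fin N), HasDensity I J (μ.real (⋃ ν, D ν)ᶜ) ∧
      LocalisedOn I Op φ J (⋃ ν, D ν)ᶜ := by
  set D₀ := (⋃ ν, D ν)ᶜ with hD₀
  obtain ⟨a, ha, hdense⟩ := exists_dense_localised_seq (d := d) μ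
    fun ν => smoothCore Φ 𝒰 (D ν) (n ν)
  obtain ⟨J, hJ⟩ := exists_diagonal (limAlong_le_atTop I)
    (fun m N (J : Finset (Fin N)) => (J.card : ℝ) ≤ μ.real D₀ * N ∧
      (μ.real D₀ - 1 / ((m : ℝ) + 1)) * N ≤ J.card ∧ ∀ i ≤ m, (1 / (N : ℝ)) *
        ∑ j ∈ J, ‖expectation (Op N (a i)) (φ N j)‖ ^ 2 ≤ 1 / ((m : ℝ) + 1))
    (fun m k N J hmk h => by
      have hle : 1 / ((k : ℝ) + 1) ≤ 1 / ((m : ℝ) + 1) := by gcongr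
      refine ⟨h.1, le_trans ?_ h.2.1, fun i hi => (h.2.2 i (hi.trans hmk)).trans hle⟩
      gcongr)
    (fun m => eventually_exists_localised hμ hΦμ hΦ hOp hU hφ hD ha m (by positivity))
  have hsmall : ∀ ε > 0, ∃ m : ℕ, 1 / ((m : ℝ) + 1) < ε := fun ε hε => exists_nat_one_div_lt hε
  refine ⟨J, ?_, fun b hb => ?_⟩
  · refine tendsto_order.2 ⟨fun c hc => ?_, fun c hc => ?_⟩
    · obtain ⟨m, hm⟩ := hsmall (μ.real D₀ - c) (sub_pos.2 hc)
      filter_upwards [hJ m, eventually_pos_limAlong I] with N hN hN0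
      have hN' : (0 : ℝ) < N := by exact_mod_cast hN0
      rw [lt_div_iff₀ hN']
      refine lt_of_lt_of_le ?_ hN.2.1
      gcongr
      linarith
    · filter_upwards [hJ 0, eventually_pos_limAlong I] with N hN hN0
      have hN' : (0 : ℝ) < N := by exact_mod_cast hN0
      exact ((div_le_iff₀ hN').2 hN.1).trans_lt hc
  · rw [← mem_nullObservables_meanSeminorm]
    have hanull : ∀ i, a i ∈ nullObservables I (meanSeminorm Op φ J) := by
      intro i
      rw [mem_nullObservables_meanSeminorm]
      refine tendsto_order.2 ⟨fun c hc => Eventually.of_forall fun N => hc.trans_le ?_,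
        fun c hc => ?_⟩
      · positivity
      · obtain ⟨m, hm⟩ := hsmall c hc
        filter_upwards [hJ (max m i)] with N hN
        refine ((hN.2.2 i (le_max_right _ _)).trans ?_).trans_lt hm
        gcongr
        exact le_max_left _ _
    refine HSBounded.mem_nullObservables hOp (hsBounded_meanSeminorm (Op := Op) (φ := φ) J)
      (mem_nullClosure_of_forall_inner fun g hg => ?_)
    -- Negligibility is built in only for the sequence `a i`; density and continuity of the inner
    -- product extend the orthogonality to all observables supported in the smooth cores. Hence `g`
    -- vanishes almost everywhere on each `D ν`, while `b` vanishes on `D₀`.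
    have hgS : ∀ c : smoothFunctions d M, (∃ ν, tsupport (c : M → ℂ) ⊆
        smoothCore Φ 𝒰 (D ν) (n ν)) → inner ℂ g (toL2 μ c) = 0 := by
      intro c hc
      have hcl : IsClosed {f : Lp ℂ 2 μ | inner ℂ g f = 0} :=
        isClosed_eq (continuous_const.inner continuous_id) continuous_const
      refine hcl.closure_subset_iff.2 ?_ (hdense c hc)
      rintro _ ⟨i, rfl⟩
      exact hg _ (hanull i)
    have hg0 : ∀ ν, ∀ᵐ x ∂μ, x ∈ D ν → g x = 0 := fun ν => by
      filter_upwards [ae_eq_zero_of_forall_inner_toL2 (d := d) g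
        (hΦ.isOpen_smoothCore (D ν) (n ν)) fun c hc => hgS c ⟨ν, hc⟩,
        measure_eq_zero_iff_ae_notMem.1
          (hΦ.measure_diff_smoothCore hμ hΦμ (hD.boundary ν) (n ν))] with x h1 h2 hxD
      refine h1 ?_
      by_contra h
      exact h2 ⟨hxD, h⟩
    rw [inner_toL2]
    refine integral_eq_zero_of_ae ?_
    filter_upwards [ae_all_iff.2 hg0] with x hx
    by_cases hxD : x ∈ D₀
    · simp [hb x hxD]
    · rw [hD₀, Set.notMem_compl_iff, Set.mem_iUnion] at hxD
      obtain ⟨ν, hν⟩ := hxD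
      simp [hx ν hν]

end Existence

/-! ### Eigenphases as points of the circle, and conclusion -/

lemma exists_isEigenbasis {I : Set ℕ} {U : (N : ℕ) → Matrix.unitaryGroup (Fin N) ℂ}
    {φ : (N : ℕ) → OrthonormalBasis (Fin N) ℂ (EuclideanSpace ℂ (Fin N))}
    (hφ : ∀ N ∈ I, ∀ j, ∃ θ : ℝ, Matrix.toEuclideanCLM (n := Fin N) (𝕜 := ℂ) (U N).1 (φ N j) =
      Complex.exp (2 * Real.pi * Complex.I * θ) • φ N j) :
    ∃ θ : (N : ℕ) → Fin N → UnitAddCircle, IsEigenbasis I U φ θ := by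
  have h : ∀ N j, ∃ t : UnitAddCircle, N ∈ I →
      Matrix.toEuclideanCLM (n := Fin N) (𝕜 := ℂ) (U N).1 (φ N j) = fourier 1 t • φ N j := by
    intro N j
    by_cases hN : N ∈ I
    · obtain ⟨t, ht⟩ := hφ N hN j
      refine ⟨(t : UnitAddCircle), fun _ => ?_⟩
      rw [ht, fourier_coe_apply]
      simp
    -- Outside `I` the phase is a dummy value.
    · exact ⟨0, fun h => absurd h hN⟩
  choose θ hθ using h
  exact ⟨θ, fun N hN j => hθ N j hN⟩

end DividedPhaseSpace

theorem mainTheorem1 {d : ℕ} {M : Type*} [TopologicalSpace M] [CompactSpace M] [T2Space M]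
    [ChartedSpace (EuclideanSpace ℝ (Fin d)) M] [IsManifold (𝓡 d) ∞ M]
    [MeasurableSpace M] [BorelSpace M]
    (μ : Measure M) [IsProbabilityMeasure μ] (hμ : DividedPhaseSpace.AbsContLebesgue d μ)
    (Φ : Equiv.Perm M) (hΦμ : MeasurePreserving Φ μ μ)
    (𝒰 : ℕ → Set M) (hΦ : DividedPhaseSpace.IsPiecewiseSmooth d Φ 𝒰)
    (I : Set ℕ) (hI : I.Infinite)
    (Op : (N : ℕ) → DividedPhaseSpace.smoothFunctions d M →ₗ[ℂ] Matrix (Fin N) (Fin N) ℂ)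
    (hOp : DividedPhaseSpace.ObservableCorrespondence μ I Op)
    (U : (N : ℕ) → Matrix.unitaryGroup (Fin N) ℂ)
    (hU : DividedPhaseSpace.MapCorrespondence Φ 𝒰 I Op U)
    (D : ℕ → Set M) (n : ℕ → ℕ) (α : ℕ → ℝ)
    (hD : DividedPhaseSpace.PeriodicDomains Φ 𝒰 I Op U D n α)
    (D₀ : Set M) (hD₀ : D₀ = (⋃ ν, D ν)ᶜ)
    (herg : Ergodic Φ (μ.restrict D₀))
    (φ : (N : ℕ) → OrthonormalBasis (Fin N) ℂ (EuclideanSpace ℂ (Fin N)))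
    (hφ : ∀ N ∈ I, ∀ j, ∃ θ : ℝ, Matrix.toEuclideanCLM (n := Fin N) (𝕜 := ℂ) (U N).1 (φ N j) =
      Complex.exp (2 * Real.pi * Complex.I * θ) • φ N j) :
    (∃ J : (N : ℕ) → Finset (Fin N), DividedPhaseSpace.HasDensity I J (μ.real D₀) ∧
      DividedPhaseSpace.LocalisedOn I Op φ J D₀) ∧
    ∀ J : (N : ℕ) → Finset (Fin N), DividedPhaseSpace.HasDensity I J (μ.real D₀) →
      DividedPhaseSpace.LocalisedOn I Op φ J D₀ →
      ∀ a : DividedPhaseSpace.smoothFunctions d M,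
        Tendsto (fun N : ℕ => (1 / (N : ℝ)) * ∑ j ∈ J N,
            ‖DividedPhaseSpace.expectation (Op N a) (φ N j)
              - ⨍ x in D₀, (a : M → ℂ) x ∂μ‖ ^ 2)
          (DividedPhaseSpace.limAlong I) (𝓝 0) := by
  subst hD₀
  obtain ⟨θ, hθ⟩ := DividedPhaseSpace.exists_isEigenbasis hφ
  exact ⟨DividedPhaseSpace.exists_localisedOn hμ hΦμ hΦ hOp hU hθ hD, fun J _ hJ a =>
    DividedPhaseSpace.tendsto_variance_of_localisedOn hμ hΦμ hΦ hOp hU hD.boundary herg hφ hJ a⟩
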